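/- Let $q\ge 2$, and let $M_0=I,M_1,\dots,M_{q^2-1}$ be $q\times q$ complex matrices with $\operatorname{tr}(M_i^\dagger M_j)=q\,\delta_{ij}$. For $\mathbf x\in\{0,\dots,q^2-1\}^n$ put $M_{\mathbf x}=M_{x_1}\otimes\cdots\otimes M_{x_n}$, $\operatorname{supp}(\mathbf x)=\{i:x_i\ne0\}$ and $|\mathbf x|=|\operatorname{supp}(\mathbf x)|$. Consider a variational circuit $U(\theta)$ on $n$ qudits of local dimension $q$, with parameters $\theta\in[0,2\pi]^p$, consisting of entangling gates and parameterized gates. Each entangling gate acts on two distinct (possibly non-adjacent) qudits, and each qudit is acted on by at least one entangling gate; the entangling gates are drawn independently, each from a probability measure on $\mathrm U(q^2)$ that is a unitary 2-design. Each entangling gate may be preceded and succeeded by any number of parameterized gates acting on one or both of its two qudits, and there are no other parameterized gates. A parameterized gate has the form $W_l\,e^{-iA\theta_j}\,W_r$, where $W_l,W_r$ are fixed unitaries, $A$ is Hermitian, $e^{-iA\theta}$ is $2\pi$-periodic in $\theta$, and $\theta_j$ is one of the parameters. Let $d$ be the entangling depth, i.e. the least number of layers of parallel gates into which the entangling gates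 can be arranged (the parameterized gates being removed). Let $\mathrm{gates}(\mathbf x)$ be the number of entangling gates acting between $\operatorname{supp}(\mathbf x)$ and its complement. Finally let $$g_{\mathbf x}=\mathbb E_V\,\mathbb E_\theta\,\bigl|\langle 0^n|U(\theta)^\dagger M_{\mathbf x}U(\theta)|0^n\rangle\bigr|^2,$$ where $\mathbb E_V$ averages over the entangling gates and $\theta$ is uniform on $[0,2\pi]^p$. There is a universal constant $K>0$ (independent of $q$, $n$, $p$, the matrices $M_i$, the circuit and $\mathbf x$) such that always $$g_{\mathbf x}\ \ge\ \max\bigl(q^{-K\,d\,|\mathbf x|},\ (q+1)^{-n}\bigr).$$ More precisely, $$g_{\mathbf x}\ \ge\ \max\bigl((q+1)^{-|\mathbf x|}(q^2+1)^{-\mathrm{gates}(\mathbf x)},\ (q+1)^{-n}\bigr)\qquad\text{and}\qquad \mathrm{gates}(\mathbf x)\le d\,|\mathbf x|.$$ -/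

import Mathlib

open Matrix MeasureTheory ProbabilityTheory

noncomputable section

/-! ### Unitary 2-designs on two qudits -/

/-- Matrices on two qudits of local dimension `q`. -/
abbrev TwoSite (q : ℕ) : Type := Matrix (Fin q × Fin q) (Fin q × Fin q) ℂ

/-- The unitary group `U(q²)`, acting on `ℂ^q ⊗ ℂ^q`. -/
abbrev U2 (q : ℕ) : Type := unitaryGroup (Fin q × Fin q) ℂ

instance instMeasurableSpaceU2 (q : ℕ) : MeasurableSpace (U2 q) := borel (U2 q)

instance instBorelSpaceU2 (q : ℕ) : BorelSpace (U2 q) := ⟨rfl⟩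

instance instCompactSpaceU2 (q : ℕ) : CompactSpace (U2 q) := by
  have hK : IsCompact (Set.univ.pi fun _ : Fin q × Fin q => Set.univ.pi
      fun _ : Fin q × Fin q => Metric.closedBall (0 : ℂ) 1) :=
    isCompact_univ_pi fun _ => isCompact_univ_pi fun _ => isCompact_closedBall 0 1
  have hC : IsClosed (unitaryGroup (Fin q × Fin q) ℂ : Set (TwoSite q)) := by
    have h : (unitaryGroup (Fin q × Fin q) ℂ : Set (TwoSite q)) = {A | A * star A = 1} := by
      ext A
      exact mem_unitaryGroup_iff
    rw [h]
    exact isClosed_eq (continuous_id.mul continuous_star) continuous_const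
  refine isCompact_iff_compactSpace.mp (hK.of_isClosed_subset hC ?_)
  intro A hA i _ j _
  simpa using entry_norm_bound_of_unitary hA i j

/-- The Haar probability measure on `U(q²)`. -/
def haarU2 (q : ℕ) : Measure (U2 q) := Measure.haarMeasure ⊤

/-- A probability measure on `U(q²)` is a (unitary) 2-design if its moments
`E[U ⊗ U ⊗ Ū ⊗ Ū]` agree, entry by entry, with those of the Haar probability measure. -/
def IsTwoDesign {q : ℕ} (μ : Measure (U2 q)) : Prop :=
  IsProbabilityMeasure μ ∧
    ∀ a a' b b' c c' d d' : Fin q × Fin q,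
      ∫ U : U2 q, (U : TwoSite q) a a' * (U : TwoSite q) b b' *
          star ((U : TwoSite q) c c') * star ((U : TwoSite q) d d') ∂μ =
        ∫ U : U2 q, (U : TwoSite q) a a' * (U : TwoSite q) b b' *
          star ((U : TwoSite q) c c') * star ((U : TwoSite q) d d') ∂(haarU2 q)

/-! ### Architectures of entangling gates -/

/-- The architecture of the entangling gates on `n` sites: `m` gates in order of application,
the `t`-th one acting on two distinct (possibly non-adjacent) sites. Every site is acted on
at least once. -/
structure Architecture (n : ℕ) where
  m : ℕ
  site₁ : Fin m → Fin n
  site₂ : Fin m → Fin n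
  site_ne : ∀ t, site₁ t ≠ site₂ t
  covers : ∀ i, ∃ t, site₁ t = i ∨ site₂ t = i

/-- Gates `s` and `t` act on a common site. -/
def Architecture.Overlap {n : ℕ} (A : Architecture n) (s t : Fin A.m) : Prop :=
  A.site₁ s = A.site₁ t ∨ A.site₁ s = A.site₂ t ∨ A.site₂ s = A.site₁ t ∨ A.site₂ s = A.site₂ t

/-- The gates can be arranged in `k` layers of parallel gates: gates of one layer act on disjoint
pairs of sites, and the order of the gates that share a site is respected. -/
def Architecture.HasLayering {n : ℕ} (A : Architecture n) (k : ℕ) : Prop :=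
  ∃ layer : Fin A.m → Fin k, ∀ s t, s < t → A.Overlap s t → layer s < layer t

/-- The entangling depth: the least number of layers of parallel entangling gates. -/
def Architecture.depth {n : ℕ} (A : Architecture n) : ℕ := sInf {k | A.HasLayering k}

/-- A set of layers exists: one gate per layer. -/
theorem Architecture.hasLayering_m {n : ℕ} (A : Architecture n) : A.HasLayering A.m :=
  ⟨id, fun _ _ h _ => h⟩

/-! ### Operators on `n` qudits -/

/-- Operators on `n` qudits of local dimension `q`, in the computational basis. -/
abbrev QuditOp (n q : ℕ) : Type := Matrix (Fin n → Fin q) (Fin n → Fin q) ℂ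

/-- The two-site operator `G` acting on sites `i` and `j` (first tensor factor on `i`), tensored
with the identity on the other sites. -/
def onSites {n q : ℕ} (i j : Fin n) (G : TwoSite q) : QuditOp n q :=
  Matrix.of fun s t => if ∀ k, k ≠ i → k ≠ j → s k = t k then G (s i, s j) (t i, t j) else 0

/-- `M : Fin (q ^ 2) → ℂ^{q × q}` is an orthogonal basis with `M 0 = I` and
`tr (M_i† M_j) = q δ_{ij}` (`q²` nonzero orthogonal elements are a basis of `ℂ^{q × q}`). -/
structure IsOperatorBasis {q : ℕ} [NeZero q]
    (M : Fin (q ^ 2) → Matrix (Fin q) (Fin q) ℂ) : Prop where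
  zero : M 0 = 1
  trace : ∀ i j, ((M i)ᴴ * M j).trace = if i = j then (q : ℂ) else 0

/-- `M_x = M_{x_1} ⊗ ⋯ ⊗ M_{x_n}`. -/
def tensorOp {n q : ℕ} (M : Fin (q ^ 2) → Matrix (Fin q) (Fin q) ℂ) (x : Fin n → Fin (q ^ 2)) :
    QuditOp n q :=
  Matrix.of fun s t => ∏ i, M (x i) (s i) (t i)

/-- The support of `x`: the sites at which `x` is nonzero. -/
def support {n q : ℕ} [NeZero q] (x : Fin n → Fin (q ^ 2)) : Finset (Fin n) :=
  Finset.univ.filter fun i => x i ≠ 0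

/-- The number of entangling gates that act between `S` and its complement. -/
def Architecture.gates {n : ℕ} (A : Architecture n) (S : Finset (Fin n)) : ℕ :=
  (Finset.univ.filter fun t => ¬ (A.site₁ t ∈ S ↔ A.site₂ t ∈ S)).card

/-! ### The variational circuit -/

/-- A parameterized gate `W_l e^{-i A θ} W_r` with `A` Hermitian, `W_l`, `W_r` fixed unitaries, and
`e^{-i A θ}` periodic in `θ` with period `2π`. It is placed next to an entangling gate and acts on
one or both of the two sites of that gate (a one-site gate is a two-site gate that is trivial on
the other tensor factor). Its parameter is the one with index `param` among the `p` parameters. -/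
structure ParamGate (q p : ℕ) where
  A : TwoSite q
  hermitian : A.IsHermitian
  periodic : Function.Periodic
    (fun θ : ℝ => NormedSpace.exp ((-(Complex.I * (θ : ℂ))) • A)) (2 * Real.pi)
  Wl : U2 q
  Wr : U2 q
  param : Fin p

/-- The unitary performed by a parameterized gate at the parameter values `θ`. -/
def ParamGate.mat {q p : ℕ} (g : ParamGate q p) (θ : Fin p → ℝ) : TwoSite q :=
  (g.Wl : TwoSite q) * NormedSpace.exp ((-(Complex.I * (θ g.param : ℂ))) • g.A) *
    (g.Wr : TwoSite q)

/-- The product of a list of parameterized gates that is given in order of application. -/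
def paramSeq {q p : ℕ} (l : List (ParamGate q p)) (θ : Fin p → ℝ) : TwoSite q :=
  (l.map fun g => g.mat θ).reverse.prod

/-- A hardware-efficient ansatz on `n` qudits of local dimension `q` with `p` parameters. Removing
the parameterized gates leaves the underlying architecture. The `t`-th entangling gate is preceded
by the parameterized gates `pre t` and succeeded by the parameterized gates `post t` on its two
sites (lists in order of application). The entangling gates are drawn independently, the `t`-th one
from the 2-design `law t`. -/
structure Ansatz (n q p : ℕ) extends Architecture n where
  pre : Fin m → List (ParamGate q p)
  post : Fin m → List (ParamGate q p)
  law : Fin m → Measure (U2 q)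
  law_design : ∀ t, IsTwoDesign (law t)

/-- The circuit unitary `U(θ)` for the realization `V` of the entangling gates. -/
def Ansatz.circuit {n q p : ℕ} (C : Ansatz n q p) (V : Fin C.m → U2 q) (θ : Fin p → ℝ) :
    QuditOp n q :=
  (List.ofFn fun t => onSites (C.site₁ t) (C.site₂ t)
    (paramSeq (C.post t) θ * (V t : TwoSite q) * paramSeq (C.pre t) θ)).reverse.prod

/-- The uniform distribution on the feasible set `[0, 2π]^p`. -/
def uniformParams (p : ℕ) : Measure (Fin p → ℝ) :=
  ProbabilityTheory.cond volume (Set.Icc 0 fun _ => 2 * Real.pi)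

/-- `g_x = E_V E_θ |⟨0^n| U(θ)† M_x U(θ) |0^n⟩|²`. -/
def Ansatz.g {n q p : ℕ} [NeZero q] (C : Ansatz n q p)
    (M : Fin (q ^ 2) → Matrix (Fin q) (Fin q) ℂ) (x : Fin n → Fin (q ^ 2)) : ℝ :=
  ∫ V : Fin C.m → U2 q, ∫ θ : Fin p → ℝ,
      ‖((C.circuit V θ)ᴴ * tensorOp M x * C.circuit V θ) 0 0‖ ^ 2
    ∂(uniformParams p) ∂(Measure.pi C.law)

end

/-! ### The Markov chain on strings -/

section Strings

open Function

/-! In the Heisenberg picture, `M_x` is conjugated by one gate after another, the last gate of the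
circuit first. If `x` vanishes at both sites of a gate, the operator there is the identity and the
gate cancels. Otherwise it is traceless there, and the average over a 2-design of the squared
modulus of any linear functional of the conjugate is the mean over all nonzero pairs of letters:
cross terms vanish and all traceless basis elements get equal weight
(`IsTwoDesign.integral_norm_sq_linearMap`, from the Haar moments in `twirlMoment_eq`). Fixed
unitaries around the gate do not affect this. So for every fixed `θ` the average over the gates
follows one Markov chain on strings, `mix` gate by gate, and the average over `θ` is trivial
(`integral_circuit`, `Ansatz.g_eq_evolve`).

At the end a string `y` is weighted by `∏ |⟨0|M_{y_i}|0⟩|²`. Every site is hit by a gate, and a gate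
makes the nonzero letters at its sites equally likely, so each nonzero letter may be given the mean
weight `r = 1/(q+1)` (`evolve_prod_eq`); Parseval computes this mean. Hence `g_x` is the expectation
of `r ^ |y|`.

Since `|y| ≤ n`, this is at least `r ^ n`. For the other bound, `r ^ |y|` decreases as the support
grows, and the chain preserves this monotonicity. A gate with both or neither of its sites in the
support cannot enlarge it. A crossing gate keeps it from growing beyond its original site with
probability at least `(q²-1)/(q⁴-1) = 1/(q²+1)`. So only crossing gates cost a factor
(`SuppAntitone.le_mix`). A crossing gate is determined by its layer and its site in the support,
which bounds their number. -/

theorem card_sq_sub_one_pos {α : Type*} [Fintype α] (hα : 1 < Fintype.card α) :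
    0 < (Fintype.card α : ℝ) ^ 2 - 1 := by
  have : (1 : ℝ) < Fintype.card α := by exact_mod_cast hα
  nlinarith

variable {ι α : Type*} [DecidableEq ι] [Fintype α] [DecidableEq α] [Zero α]

/-- Average of `f` over the nonzero pairs placed at the sites `i`, `j`, unless both sites of the
string vanish. -/
noncomputable def mix (i j : ι) (f : (ι → α) → ℝ) (x : ι → α) : ℝ :=
  if x i = 0 ∧ x j = 0 then f x else
    (∑ p : α × α, if p = 0 then 0 else f (update (update x i p.1) j p.2)) /
      ((Fintype.card α : ℝ) ^ 2 - 1)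

/-- Average of `f` over the nonzero letters placed at site `i`, unless the string vanishes there. -/
noncomputable def siteAvg (i : ι) (f : (ι → α) → ℝ) (x : ι → α) : ℝ :=
  if x i = 0 then f x else
    (∑ a : α, if a = 0 then 0 else f (update x i a)) / ((Fintype.card α : ℝ) - 1)

/-- Successive application of `mix` for a sequence of gates. -/
noncomputable def evolve : (m : ℕ) → (Fin m → ι × ι) → ((ι → α) → ℝ) → (ι → α) → ℝ
  | 0, _, f => f
  | m + 1, g, f =>
    mix (g (Fin.last m)).1 (g (Fin.last m)).2 (evolve m (fun t => g t.castSucc) f)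

theorem mix_swap {i j : ι} (h : i ≠ j) (f : (ι → α) → ℝ) : mix i j f = mix j i f := by
  funext x
  unfold mix
  simp only [and_comm (a := x i = 0)]
  congr 2
  rw [← (Equiv.prodComm α α).sum_comp]
  refine Finset.sum_congr rfl fun p _ => ?_
  simp only [Equiv.prodComm_apply, Prod.fst_swap, Prod.snd_swap, Prod.ext_iff, Prod.fst_zero,
    Prod.snd_zero, and_comm (a := p.1 = 0)]
  rw [update_comm h]

theorem sum_ite_ne_zero_const (c : ℝ) :
    (∑ a : α, if a = 0 then 0 else c) = ((Fintype.card α : ℝ) - 1) * c := by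
  have h : ∀ a : α, (if a = 0 then 0 else c) = c - if a = 0 then c else 0 := by
    intro a; split_ifs <;> simp
  simp only [h, Finset.sum_sub_distrib, Finset.sum_const, Finset.card_univ, nsmul_eq_mul,
    Finset.sum_ite_eq', Finset.mem_univ, if_true]
  ring

theorem sum_prod_ne_zero_const (c : ℝ) :
    (∑ p : α × α, if p = 0 then 0 else c) = ((Fintype.card α : ℝ) ^ 2 - 1) * c := by
  rw [sum_ite_ne_zero_const, Fintype.card_prod]
  push_cast
  ring

/-! ### Letter averages absorbed by the chain -/

theorem sum_siteAvg_update (hα : 1 < Fintype.card α) (i : ι) (f : (ι → α) → ℝ) (x : ι → α) :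
    (∑ a : α, if a = 0 then 0 else siteAvg i f (update x i a)) =
      ∑ a : α, if a = 0 then 0 else f (update x i a) := by
  have hc : (Fintype.card α : ℝ) - 1 ≠ 0 := by
    have : (1 : ℝ) < Fintype.card α := by exact_mod_cast hα
    linarith
  have h : ∀ a : α, (if a = 0 then 0 else siteAvg i f (update x i a)) = if a = 0 then 0 else
      (∑ a : α, if a = 0 then 0 else f (update x i a)) / ((Fintype.card α : ℝ) - 1) := by
    intro a
    by_cases ha : a = 0
    · simp [ha]
    · simp [siteAvg, ha]
  simp only [h, sum_ite_ne_zero_const]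
  field_simp

/-- For each fixed letter at `i`, the uniform law on nonzero pairs weights the nonzero letters at
`j` equally. The excluded pair `(0, 0)` only removes the letter `0`, on which `siteAvg` does
nothing. -/
theorem mix_siteAvg_right (hα : 1 < Fintype.card α) {i j : ι} (f : (ι → α) → ℝ) :
    mix i j (siteAvg j f) = mix i j f := by
  funext x
  unfold mix
  by_cases hx : x i = 0 ∧ x j = 0
  · simp [hx, siteAvg]
  · rw [if_neg hx, if_neg hx]
    congr 1
    simp only [Fintype.sum_prod_type, Prod.ext_iff, Prod.fst_zero, Prod.snd_zero]
    refine Finset.sum_congr rfl fun a _ => ?_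
    by_cases ha : a = 0
    · simp only [ha, true_and]
      exact sum_siteAvg_update hα j f _
    · have e : ∀ h : (ι → α) → ℝ, (∑ b : α, h (update (update x i a) j b)) =
          h (update (update x i a) j 0) +
            ∑ b : α, if b = 0 then 0 else h (update (update x i a) j b) := by
        intro h
        rw [← Finset.add_sum_erase _ _ (Finset.mem_univ (0 : α)),
          ← Finset.add_sum_erase (a := (0 : α)) _ (fun b => if b = 0 then _ else _)
            (Finset.mem_univ (0 : α))]
        simp only [if_true, zero_add]
        congr 1
        refine Finset.sum_congr rfl fun b hb => ?_
        rw [if_neg (Finset.ne_of_mem_erase hb)]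
      simp only [ha, false_and, if_false]
      rw [e, e, sum_siteAvg_update hα]
      simp [siteAvg]

theorem mix_siteAvg_left (hα : 1 < Fintype.card α) {i j : ι} (hij : i ≠ j) (f : (ι → α) → ℝ) :
    mix i j (siteAvg i f) = mix i j f := by
  rw [mix_swap hij, mix_siteAvg_right hα, mix_swap hij]

theorem siteAvg_mix {i j k : ι} (hi : k ≠ i) (hj : k ≠ j) (f : (ι → α) → ℝ) :
    siteAvg k (mix i j f) = mix i j (siteAvg k f) := by
  funext x
  by_cases hk : x k = 0
  · simp [siteAvg, mix, hk, hi, hj]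
  · by_cases hx : x i = 0 ∧ x j = 0
    · simp [siteAvg, mix, hk, hi.symm, hj.symm, hx]
    · have e : ∀ (a : α) (p : α × α), update (update (update x k a) i p.1) j p.2 =
          update (update (update x i p.1) j p.2) k a := by
        intro a p
        rw [update_comm hi, update_comm hj]
      simp only [siteAvg, mix, hk, hi, hj, hi.symm, hj.symm, hx, if_false, update_of_ne, ne_eq,
        not_false_eq_true, e]
      have l : ∀ a : α, (if a = 0 then 0 else
          (∑ p : α × α, if p = 0 then 0 else f (update (update (update x i p.1) j p.2) k a)) /
            ((Fintype.card α : ℝ) ^ 2 - 1)) = (∑ p : α × α, if p = 0 then 0 else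
              if a = 0 then 0 else f (update (update (update x i p.1) j p.2) k a)) /
            ((Fintype.card α : ℝ) ^ 2 - 1) := by
        intro a; by_cases ha : a = 0 <;> simp [ha]
      have r : ∀ p : α × α, (if p = 0 then 0 else
          (∑ a : α, if a = 0 then 0 else f (update (update (update x i p.1) j p.2) k a)) /
            ((Fintype.card α : ℝ) - 1)) = (∑ a : α, if p = 0 then 0 else
              if a = 0 then 0 else f (update (update (update x i p.1) j p.2) k a)) /
            ((Fintype.card α : ℝ) - 1) := by
        intro p; by_cases hp : p = 0 <;> simp [hp]
      simp only [l, r, ← Finset.sum_div]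
      rw [Finset.sum_comm, div_right_comm]

theorem siteAvg_evolve {k : ι} (m : ℕ) (g : Fin m → ι × ι)
    (hg : ∀ t, k ≠ (g t).1 ∧ k ≠ (g t).2) (f : (ι → α) → ℝ) :
    siteAvg k (evolve m g f) = evolve m g (siteAvg k f) := by
  induction m with
  | zero => rfl
  | succ m ih =>
    simp only [evolve]
    rw [siteAvg_mix (hg _).1 (hg _).2, ih _ fun t => hg _]

/-- The first gate of the circuit that touches `k` absorbs the average at `k`; the gates before it
do not touch `k`, so the average commutes past them. -/
theorem evolve_siteAvg (hα : 1 < Fintype.card α) {k : ι} (m : ℕ) (g : Fin m → ι × ι)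
    (hne : ∀ t, (g t).1 ≠ (g t).2) (hg : ∃ t, (g t).1 = k ∨ (g t).2 = k) (f : (ι → α) → ℝ) :
    evolve m g (siteAvg k f) = evolve m g f := by
  induction m with
  | zero => exact hg.choose.elim0
  | succ m ih =>
    simp only [evolve]
    by_cases h : ∃ t : Fin m, (g t.castSucc).1 = k ∨ (g t.castSucc).2 = k
    · rw [ih _ (fun t => hne _) h]
    · push Not at h
      rw [← siteAvg_evolve _ _ fun t => ⟨(h t).1.symm, (h t).2.symm⟩]
      obtain ⟨t, ht⟩ := hg
      induction t using Fin.lastCases with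
      | cast t => exact absurd ht (by simpa using h t)
      | last =>
        rcases ht with rfl | rfl
        · exact mix_siteAvg_left hα (hne _) _
        · exact mix_siteAvg_right hα _

/-- Sites are treated one at a time: inserting `siteAvg k` for free turns the factor `w (x k)` into
its mean `r` over nonzero letters and leaves the other factors alone. Coverage of every site by a
gate is essential. -/
theorem evolve_prod_eq [Fintype ι] (hα : 1 < Fintype.card α) (m : ℕ) (g : Fin m → ι × ι)
    (hne : ∀ t, (g t).1 ≠ (g t).2) (hg : ∀ k, ∃ t, (g t).1 = k ∨ (g t).2 = k)
    (w : α → ℝ) (r : ℝ) (w0 : w 0 = 1)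
    (hw : (∑ a, if a = 0 then 0 else w a) = ((Fintype.card α : ℝ) - 1) * r) :
    evolve m g (fun x => ∏ i, w (x i)) = evolve m g (fun x => ∏ i, if x i = 0 then 1 else r) := by
  have hc : (Fintype.card α : ℝ) - 1 ≠ 0 := by
    have : (1 : ℝ) < Fintype.card α := by exact_mod_cast hα
    linarith
  -- `W` is the set of sites whose weights are already averaged.
  have key : ∀ W : Finset ι, evolve m g (fun x => ∏ i, w (x i)) = evolve m g
      (fun x => ∏ i, if i ∈ W then (if x i = 0 then 1 else r) else w (x i)) := by
    intro W
    induction W using Finset.induction_on with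
    | empty => simp
    | insert k W hk ih =>
      rw [ih, ← evolve_siteAvg hα m g hne (hg k)]
      congr 1
      funext x
      have e : ∀ y : ι → α, (∏ i, if i ∈ W then (if y i = 0 then 1 else r) else w (y i)) =
          w (y k) * ∏ i ∈ Finset.univ.erase k,
            if i ∈ W then (if y i = 0 then 1 else r) else w (y i) := by
        intro y
        rw [← Finset.mul_prod_erase _ _ (Finset.mem_univ k)]
        simp [hk]
      have e' : (∏ i, if i ∈ insert k W then (if x i = 0 then 1 else r) else w (x i)) =
          (if x k = 0 then 1 else r) * ∏ i ∈ Finset.univ.erase k,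
            if i ∈ W then (if x i = 0 then 1 else r) else w (x i) := by
        rw [← Finset.mul_prod_erase _ _ (Finset.mem_univ k)]
        simp only [Finset.mem_insert_self, if_true]
        congr 1
        refine Finset.prod_congr rfl fun i hi => ?_
        simp [Finset.ne_of_mem_erase hi]
      have c : ∀ a, (∏ i ∈ Finset.univ.erase k, if i ∈ W then
          (if update x k a i = 0 then 1 else r) else w (update x k a i)) =
          ∏ i ∈ Finset.univ.erase k, if i ∈ W then (if x i = 0 then 1 else r) else w (x i) := by
        intro a
        refine Finset.prod_congr rfl fun i hi => ?_
        rw [update_of_ne (Finset.ne_of_mem_erase hi)]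
      rw [e']
      unfold siteAvg
      by_cases hx : x k = 0
      · simp [e, hx, w0]
      · have z : ∀ (a : α) (c : ℝ), (if a = 0 then 0 else w a * c) =
            (if a = 0 then 0 else w a) * c := by
          intro a c; split_ifs <;> simp
        simp only [e, c, update_self, z, ← Finset.sum_mul, hw, hx, if_false]
        field_simp
  simpa using key Finset.univ

/-! ### Monotonicity in the support -/

/-- `f` decreases when the support of the string grows. -/
def SuppAntitone (f : (ι → α) → ℝ) : Prop :=
  ∀ x y : ι → α, (∀ i, y i = 0 → x i = 0) → f y ≤ f x

theorem le_mix (hα : 1 < Fintype.card α) {i j : ι} {f : (ι → α) → ℝ} {x : ι → α} {c : ℝ}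
    (h₀ : c ≤ f x) (h : ∀ a b, (a, b) ≠ 0 → c ≤ f (update (update x i a) j b)) :
    c ≤ mix i j f x := by
  unfold mix
  split_ifs with hx
  · exact h₀
  · rw [le_div_iff₀ (card_sq_sub_one_pos hα), mul_comm, ← sum_prod_ne_zero_const]
    refine Finset.sum_le_sum fun p _ => ?_
    split_ifs with hp
    · rfl
    · exact h _ _ hp

/-- If both strings are resampled, the same pair is put into both and the terms are compared. If
only `y` is resampled, `x` vanishes at both sites, so its support stays inside that of every
outcome. -/
theorem SuppAntitone.mix (hα : 1 < Fintype.card α) {i j : ι}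
    {f : (ι → α) → ℝ} (hf : SuppAntitone f) : SuppAntitone (mix i j f) := by
  intro x y hxy
  have hup : ∀ a b k, update (update y i a) j b k = 0 → update (update x i a) j b k = 0 := by
    intro a b k
    simp only [update_apply]
    split_ifs <;> simp_all
  by_cases hy : y i = 0 ∧ y j = 0
  · have hx : x i = 0 ∧ x j = 0 := ⟨hxy _ hy.1, hxy _ hy.2⟩
    simpa [_root_.mix, hx, hy] using hf x y hxy
  · by_cases hx : x i = 0 ∧ x j = 0
    · simp only [_root_.mix, hx, hy, and_self, if_true, if_false]
      rw [div_le_iff₀ (card_sq_sub_one_pos hα), mul_comm, ← sum_prod_ne_zero_const]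
      refine Finset.sum_le_sum fun p _ => ?_
      split_ifs with hp
      · rfl
      · refine hf _ _ fun k => ?_
        simp only [update_apply]
        split_ifs with h1 h2
        · intro _; rw [h1]; exact hx.2
        · intro _; rw [h2]; exact hx.1
        · exact hxy k
    · simp only [_root_.mix, hx, hy, if_false]
      refine div_le_div_of_nonneg_right ?_ (card_sq_sub_one_pos hα).le
      refine Finset.sum_le_sum fun p _ => ?_
      split_ifs with hp
      · rfl
      · exact hf _ _ (hup _ _)

theorem SuppAntitone.evolve (hα : 1 < Fintype.card α) (m : ℕ) (g : Fin m → ι × ι)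
    {f : (ι → α) → ℝ} (hf : SuppAntitone f) : SuppAntitone (evolve m g f) := by
  induction m with
  | zero => exact hf
  | succ m ih => exact (ih _).mix hα

theorem le_evolve (hα : 1 < Fintype.card α) (m : ℕ) (g : Fin m → ι × ι)
    {f : (ι → α) → ℝ} {c : ℝ} (hf : ∀ x, c ≤ f x) (x : ι → α) : c ≤ evolve m g f x := by
  induction m generalizing x with
  | zero => exact hf x
  | succ m ih => exact le_mix hα (ih _ _) fun a b _ => ih _ _

/-- Only the pairs `(a, 0)` with `a ≠ 0` are kept. With `c` letters they are `c - 1` of the `c ^ 2 -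
1` nonzero pairs, a fraction `1 / (c + 1)`, and they do not enlarge the support because `x i ≠ 0`.
-/
theorem SuppAntitone.le_mix_right (hα : 1 < Fintype.card α) {i j : ι}
    {f : (ι → α) → ℝ} (hf : SuppAntitone f) (h₀ : ∀ x, 0 ≤ f x) {x : ι → α} (hi : x i ≠ 0) :
    1 / ((Fintype.card α : ℝ) + 1) * f x ≤ _root_.mix i j f x := by
  have hc : (1 : ℝ) < Fintype.card α := by exact_mod_cast hα
  simp only [_root_.mix, hi, false_and, if_false]
  rw [le_div_iff₀ (card_sq_sub_one_pos hα)]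
  calc 1 / ((Fintype.card α : ℝ) + 1) * f x * ((Fintype.card α : ℝ) ^ 2 - 1)
      = ((Fintype.card α : ℝ) - 1) * f x := by field_simp; ring
    _ = ∑ a : α, if a = 0 then 0 else f x := (sum_ite_ne_zero_const _).symm
    _ ≤ ∑ a : α, ∑ b : α, if (a, b) = 0 then 0 else f (update (update x i a) j b) := ?_
    _ = _ := by rw [Fintype.sum_prod_type]
  refine Finset.sum_le_sum fun a _ => ?_
  have hnn : ∀ b : α, 0 ≤ if (a, b) = 0 then 0 else f (update (update x i a) j b) := by
    intro b; split_ifs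
    · rfl
    · exact h₀ _
  refine le_trans ?_ (Finset.single_le_sum (fun b _ => hnn b) (Finset.mem_univ (0 : α)))
  by_cases ha : a = 0
  · simp [ha]
  · simp only [ha, if_false, Prod.mk_eq_zero, false_and]
    refine hf _ _ fun k => ?_
    simp only [update_apply]
    split_ifs with h1 h2
    · intro _; rfl
    · intro h; rw [h2] at h; exact absurd h hi
    · exact id

theorem SuppAntitone.le_mix (hα : 1 < Fintype.card α) {i j : ι} (hij : i ≠ j)
    {f : (ι → α) → ℝ} (hf : SuppAntitone f) (h₀ : ∀ x, 0 ≤ f x) (x : ι → α) :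
    (if (x i ≠ 0 ↔ x j ≠ 0) then 1 else 1 / ((Fintype.card α : ℝ) + 1)) * f x ≤
      _root_.mix i j f x := by
  by_cases hi : x i = 0 <;> by_cases hj : x j = 0
  · simp [hi, hj, _root_.mix]
  · simp only [hi, hj, ne_eq, not_true, not_false_eq_true, iff_true, if_false]
    rw [mix_swap hij]
    exact hf.le_mix_right hα h₀ hj
  · simp only [hi, hj, ne_eq, not_true, not_false_eq_true, iff_false, if_false]
    exact hf.le_mix_right hα h₀ hi
  · simp only [hi, hj, ne_eq, not_false_eq_true, if_true, one_mul]
    refine _root_.le_mix hα le_rfl fun a b _ => hf _ _ fun k => ?_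
    intro hk
    have h1 : k ≠ i := by rintro rfl; exact hi hk
    have h2 : k ≠ j := by rintro rfl; exact hj hk
    simpa [h1, h2] using hk

/-- Every one-gate bound compares values at the same string `x`, so the factors are all read off the
initial support, however the chain moves. -/
theorem SuppAntitone.le_evolve (hα : 1 < Fintype.card α) (m : ℕ) (g : Fin m → ι × ι)
    (hne : ∀ t, (g t).1 ≠ (g t).2) {f : (ι → α) → ℝ} (hf : SuppAntitone f) (h₀ : ∀ x, 0 ≤ f x)
    (x : ι → α) :
    (∏ t, if (x (g t).1 ≠ 0 ↔ x (g t).2 ≠ 0) then 1 else 1 / ((Fintype.card α : ℝ) + 1)) * f x ≤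
      _root_.evolve m g f x := by
  induction m with
  | zero => simp [_root_.evolve]
  | succ m ih =>
    rw [Fin.prod_univ_castSucc, mul_right_comm, mul_comm]
    refine le_trans ?_ ((hf.evolve hα m _).le_mix hα (hne _) (_root_.le_evolve hα m _ h₀) x)
    refine mul_le_mul_of_nonneg_left (ih _ fun t => hne _) ?_
    split_ifs <;> positivity

end Strings

/-! ### Second moments of the adjoint action -/

instance instSecondCountableTopologyMatrix {m n : Type*} [Countable m] [Countable n] :
    SecondCountableTopology (Matrix m n ℂ) :=
  inferInstanceAs (SecondCountableTopology (m → n → ℂ))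

instance instSecondCountableTopologyU2 (q : ℕ) : SecondCountableTopology (U2 q) :=
  TopologicalSpace.Subtype.secondCountableTopology _

instance instIsProbabilityMeasureHaarU2 (q : ℕ) : IsProbabilityMeasure (haarU2 q) :=
  ⟨Measure.haarMeasure_self⟩

instance instIsHaarMeasureHaarU2 (q : ℕ) : (haarU2 q).IsHaarMeasure := by
  unfold haarU2
  infer_instance

/-- A right translate of the Haar measure is again a Haar probability measure, and such a measure is
unique. -/
instance instIsMulRightInvariantHaarU2 (q : ℕ) : (haarU2 q).IsMulRightInvariant := by
  constructor
  intro g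
  have : IsProbabilityMeasure ((haarU2 q).map (· * g)) :=
    Measure.isProbabilityMeasure_map (by fun_prop)
  exact Measure.isHaarMeasure_eq_of_isProbabilityMeasure _ _

theorem integrable_of_continuous_compactSpace {X E : Type*} [TopologicalSpace X] [CompactSpace X]
    [MeasurableSpace X] [OpensMeasurableSpace X] [NormedAddCommGroup E] {μ : Measure X}
    [IsFiniteMeasure μ] {f : X → E} (hf : Continuous f) : Integrable f μ :=
  hf.integrable_of_hasCompactSupport (HasCompactSupport.of_compactSpace f)

section Moments

variable {q : ℕ}

/-- The conjugate `U† A U`. -/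
noncomputable def twirl (A : TwoSite q) (U : U2 q) : TwoSite q := (U : TwoSite q)ᴴ * A * U

theorem continuous_twirl (A : TwoSite q) : Continuous (twirl A) := by
  unfold twirl
  fun_prop

theorem continuous_twirl_apply (A : TwoSite q) (i j : Fin q × Fin q) :
    Continuous fun U => twirl A U i j := (continuous_twirl A).matrix_elem i j

theorem trace_twirl (A : TwoSite q) (U : U2 q) : (twirl A U).trace = A.trace := by
  rw [twirl, trace_mul_cycle, ← star_eq_conjTranspose, mem_unitaryGroup_iff.mp U.2, one_mul]

theorem trace_conjTranspose_mul_twirl (A : TwoSite q) (U : U2 q) :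
    ((twirl A U)ᴴ * twirl A U).trace = (Aᴴ * A).trace := by
  have h : (twirl A U)ᴴ * twirl A U = twirl (Aᴴ * A) U := by
    have h1 : (U : TwoSite q) * (U : TwoSite q)ᴴ = 1 := mem_unitaryGroup_iff.mp U.2
    simp only [twirl, conjTranspose_mul, conjTranspose_conjTranspose, Matrix.mul_assoc]
    rw [← Matrix.mul_assoc (U : TwoSite q) (U : TwoSite q)ᴴ, h1, Matrix.one_mul]
  rw [h, trace_twirl]

/-- Second moments of the entries of `U† A U` for a Haar random `U`. -/
noncomputable def twirlMoment (A : TwoSite q) (i j k l : Fin q × Fin q) : ℂ :=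
  ∫ U, twirl A U i j * star (twirl A U k l) ∂haarU2 q

theorem integrable_twirl_mul_star (A : TwoSite q) (i j k l : Fin q × Fin q) :
    Integrable (fun U => twirl A U i j * star (twirl A U k l)) (haarU2 q) :=
  integrable_of_continuous_compactSpace
    ((continuous_twirl_apply A i j).mul (continuous_twirl_apply A k l).star)

theorem integral_sum_twirl {κ : Type*} [Fintype κ] (A : TwoSite q) (u : κ → ℂ)
    (s t : κ → Fin q × Fin q) :
    ∫ U, (∑ c, u c * twirl A U (s c) (t c)) * star (∑ c, u c * twirl A U (s c) (t c)) ∂haarU2 q =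
      ∑ c, ∑ c', u c * star (u c') * twirlMoment A (s c) (t c) (s c') (t c') := by
  simp only [twirlMoment, ← integral_const_mul]
  have hi : ∀ c c', Integrable (fun U => u c * star (u c') *
      (twirl A U (s c) (t c) * star (twirl A U (s c') (t c')))) (haarU2 q) :=
    fun c c' => (integrable_twirl_mul_star A _ _ _ _).const_mul _
  simp only [← integral_finsetSum _ fun c' _ => hi _ c']
  rw [← integral_finsetSum _ fun c _ => integrable_finsetSum _ fun c' _ => hi c c']
  congr 1
  funext U
  rw [star_sum, Finset.sum_mul_sum]
  refine Finset.sum_congr rfl fun c _ => Finset.sum_congr rfl fun c' _ => ?_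
  rw [star_mul']
  ring

/-- This is right invariance under `U ↦ U W⁻¹`. The choices of `W` below (phases, transpositions,
and a root of a transposition) suffice to determine all moments. -/
theorem integral_conj_twirl (A : TwoSite q) (W : U2 q) (i j k l : Fin q × Fin q) :
    ∫ U, ((W : TwoSite q) * twirl A U * (W : TwoSite q)ᴴ) i j *
      star (((W : TwoSite q) * twirl A U * (W : TwoSite q)ᴴ) k l) ∂haarU2 q = twirlMoment A i j k l := by
  rw [twirlMoment, ← integral_mul_right_eq_self
    (fun U => twirl A U i j * star (twirl A U k l)) W⁻¹]
  have h : ∀ U : U2 q, twirl A (U * W⁻¹) =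
      (W : TwoSite q) * twirl A U * (W : TwoSite q)ᴴ := by
    intro U
    have hW : ((W⁻¹ : U2 q) : TwoSite q) = (W : TwoSite q)ᴴ := rfl
    simp only [twirl, Submonoid.coe_mul, hW, conjTranspose_mul, conjTranspose_conjTranspose,
      Matrix.mul_assoc]
  simp only [h]

theorem twirlMoment_phase (A : TwoSite q) (a i j k l : Fin q × Fin q) :
    twirlMoment A i j k l = (if i = a then Complex.I else 1) * star (if j = a then Complex.I else 1) *
      star (if k = a then Complex.I else 1) * (if l = a then Complex.I else 1) *
        twirlMoment A i j k l := by
  set d : Fin q × Fin q → ℂ := fun i => if i = a then Complex.I else 1 with hd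
  have hW : diagonal d ∈ unitaryGroup (Fin q × Fin q) ℂ := by
    rw [mem_unitaryGroup_iff, star_eq_conjTranspose, diagonal_conjTranspose, diagonal_mul_diagonal,
      ← diagonal_one]
    congr 1
    funext i
    by_cases h : i = a <;> simp [hd, h]
  conv_lhs => rw [← integral_conj_twirl A ⟨diagonal d, hW⟩]
  change _ = d i * star (d j) * star (d k) * d l * twirlMoment A i j k l
  rw [twirlMoment, ← integral_const_mul]
  congr 1
  funext U
  simp only [diagonal_conjTranspose, mul_diagonal, diagonal_mul, Pi.star_apply, star_mul', star_star]
  ring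

/-- For any other index pattern, a phase `I` at a suitable index multiplies the moment by some `z ≠
1` while leaving it invariant. -/
theorem twirlMoment_eq_zero (A : TwoSite q) {i j k l : Fin q × Fin q} (h₁ : ¬ (i = k ∧ j = l))
    (h₂ : ¬ (i = j ∧ k = l)) : twirlMoment A i j k l = 0 := by
  have key : ∀ z : ℂ, z ≠ 1 → twirlMoment A i j k l = z * twirlMoment A i j k l → twirlMoment A i j k l = 0 := by
    intro z hz h
    have : (1 - z) * twirlMoment A i j k l = 0 := by rw [sub_mul, one_mul, ← h, sub_self]
    exact (mul_eq_zero.mp this).resolve_left (sub_ne_zero.mpr hz.symm)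
  have hI : Complex.I ≠ 1 := fun h => by simpa using congrArg Complex.re h
  have hI2 : -Complex.I ≠ 1 := fun h => by simpa using congrArg Complex.re h
  have hm : (-1 : ℂ) ≠ 1 := by norm_num
  by_cases hij : i = j
  · subst hij
    have hkl : k ≠ l := fun h => h₂ ⟨rfl, h⟩
    refine key _ ?_ (twirlMoment_phase A k i i k l)
    by_cases hik : i = k <;> simp [hik, hkl.symm, hI2]
  · by_cases hik : i = k
    · subst hik
      have hjl : l ≠ j := fun h => h₁ ⟨rfl, h.symm⟩
      refine key _ ?_ (twirlMoment_phase A j i j i l)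
      simp [hij, hjl, hI2]
    · refine key _ ?_ (twirlMoment_phase A i i j k l)
      have hji : j ≠ i := fun h => hij h.symm
      have hki : k ≠ i := fun h => hik h.symm
      by_cases hl : l = i <;> simp [hl, hji, hki, hI, hm]

/-- The permutation matrix of a transposition. -/
noncomputable def swapMat (a b : Fin q × Fin q) : TwoSite q := (Equiv.swap a b).permMatrix ℂ

theorem swapMat_mul (a b : Fin q × Fin q) (X : TwoSite q) :
    swapMat a b * X = X.submatrix (Equiv.swap a b) id := by
  rw [swapMat, Equiv.Perm.permMatrix, PEquiv.toMatrix_toPEquiv_mul]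

theorem mul_swapMat (a b : Fin q × Fin q) (X : TwoSite q) :
    X * swapMat a b = X.submatrix id (Equiv.swap a b) := by
  rw [swapMat, Equiv.Perm.permMatrix, PEquiv.mul_toMatrix_toPEquiv, Equiv.symm_swap]

theorem swapMat_mul_self (a b : Fin q × Fin q) : swapMat a b * swapMat a b = 1 := by
  rw [swapMat, ← permMatrix_mul, Equiv.swap_mul_self, permMatrix_one]

theorem conjTranspose_swapMat (a b : Fin q × Fin q) : (swapMat a b)ᴴ = swapMat a b := by
  rw [swapMat, conjTranspose_permMatrix, Equiv.swap_inv]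

theorem twirlMoment_swap (A : TwoSite q) (a b i j k l : Fin q × Fin q) :
    twirlMoment A (Equiv.swap a b i) (Equiv.swap a b j) (Equiv.swap a b k) (Equiv.swap a b l) =
      twirlMoment A i j k l := by
  have hW : swapMat a b ∈ unitaryGroup (Fin q × Fin q) ℂ := by
    rw [mem_unitaryGroup_iff, star_eq_conjTranspose, conjTranspose_swapMat, swapMat_mul_self]
  conv_rhs => rw [← integral_conj_twirl A ⟨swapMat a b, hW⟩]
  simp only [conjTranspose_swapMat, swapMat_mul, mul_swapMat]
  rfl

theorem twirlMoment_swap_eq_add (A : TwoSite q) {a b : Fin q × Fin q} (hab : a ≠ b) :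
    twirlMoment A a a a a = twirlMoment A a b a b + twirlMoment A a a b b := by
  -- With these values `c • 1 + d • swapMat a b` is a unitary square root of the transposition. It
  -- mixes `a` and `b` with equal moduli, which links the fully diagonal moment to the other two
  -- kinds.
  set c : ℂ := (1 + Complex.I) / 2 with hc
  set d : ℂ := (1 - Complex.I) / 2 with hd
  have sc : star c = d := by
    apply Complex.ext <;> simp [hc, hd]
  have sd : star d = c := by rw [← sc, star_star]
  have I2 : Complex.I * Complex.I = -1 := Complex.I_mul_I
  have cd : c * d + d * c = 1 := by
    rw [hc, hd]; linear_combination (-1 / 2 : ℂ) * I2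
  have cc : c * c + d * d = 0 := by
    rw [hc, hd]; linear_combination (1 / 2 : ℂ) * I2
  clear_value c d
  have hWs : (c • (1 : TwoSite q) + d • swapMat a b)ᴴ = d • (1 : TwoSite q) + c • swapMat a b := by
    rw [conjTranspose_add, conjTranspose_smul, conjTranspose_smul, conjTranspose_swapMat,
      conjTranspose_one, sc, sd]
  have hW : c • (1 : TwoSite q) + d • swapMat a b ∈ unitaryGroup (Fin q × Fin q) ℂ := by
    rw [mem_unitaryGroup_iff, star_eq_conjTranspose, hWs]
    simp only [add_mul, mul_add, Matrix.smul_mul, Matrix.mul_smul, one_mul, mul_one,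
      swapMat_mul_self, smul_smul]
    have : (d * c) • (1 : TwoSite q) + (d * d) • swapMat a b +
        ((c * c) • swapMat a b + (c * d) • (1 : TwoSite q)) =
        (c * d + d * c) • (1 : TwoSite q) + (c * c + d * d) • swapMat a b := by
      module
    rw [this, cd, cc, one_smul, zero_smul, add_zero]
  have h := integral_conj_twirl A ⟨_, hW⟩ a a a a
  simp only [hWs] at h
  have e : ∀ X : TwoSite q, ((c • (1 : TwoSite q) + d • swapMat a b) * X *
      (d • (1 : TwoSite q) + c • swapMat a b)) a a =
      ∑ p : Bool × Bool, (bif p.1 then c else d) * (bif p.2 then d else c) *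
        X (bif p.1 then a else b) (bif p.2 then a else b) := by
    intro X
    simp only [add_mul, mul_add, Matrix.smul_mul, Matrix.mul_smul, one_mul, mul_one,
      swapMat_mul, mul_swapMat, Fintype.sum_prod_type, Fintype.sum_bool, cond_true, cond_false,
      Matrix.add_apply, Matrix.smul_apply, submatrix_apply, id, Equiv.swap_apply_left, smul_eq_mul]
    ring
  simp only [e] at h
  rw [integral_sum_twirl A (fun p : Bool × Bool => (bif p.1 then c else d) * (bif p.2 then d else c))
    (fun p => bif p.1 then a else b) (fun p => bif p.2 then a else b)] at h
  have h1 := twirlMoment_swap A a b a a a a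
  have h2 := twirlMoment_swap A a b a a b b
  have h3 := twirlMoment_swap A a b a b a b
  simp only [Equiv.swap_apply_left, Equiv.swap_apply_right] at h1 h2 h3
  have hba := hab.symm
  have z : ∀ i j k l : Fin q × Fin q, ¬ (i = k ∧ j = l) → ¬ (i = j ∧ k = l) →
      twirlMoment A i j k l = 0 := fun i j k l => twirlMoment_eq_zero A
  simp only [Fintype.sum_prod_type, Fintype.sum_bool, cond_true, cond_false, star_mul', sc, sd,
    h1, h2, h3] at h
  rw [z a a a b, z a a b a, z a b a a, z a b b a, z a b b b, z b a a a, z b a a b, z b a b b,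
    z b b a b, z b b b a] at h
  · have e1 : c * d = 1 / 2 := by linear_combination (1 / 2 : ℂ) * cd
    linear_combination (-2 : ℂ) * h + 4 * (twirlMoment A a a a a + twirlMoment A a b a b +
      twirlMoment A a a b b) * (c * d + 1 / 2) * e1
  all_goals simp [hab, hba]

theorem twirlMoment_swap_of_ne (A : TwoSite q) {a b c : Fin q × Fin q} (hb : a ≠ b) (hc : a ≠ c) :
    twirlMoment A a a b b = twirlMoment A a a c c := by
  have h := twirlMoment_swap A b c a a b b
  rw [Equiv.swap_apply_of_ne_of_ne hb hc, Equiv.swap_apply_left] at h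
  exact h.symm

theorem twirlMoment_offDiag_eq (A : TwoSite q) {a b c d : Fin q × Fin q} (hab : a ≠ b)
    (hcd : c ≠ d) : twirlMoment A a a b b = twirlMoment A c c d d := by
  by_cases hca : c = a
  · subst hca
    exact twirlMoment_swap_of_ne A hab hcd
  · rw [twirlMoment_swap_of_ne A hab (Ne.symm hca), ← twirlMoment_swap_of_ne A hca hcd]
    have h := twirlMoment_swap A a c a a c c
    simpa only [Equiv.swap_apply_left, Equiv.swap_apply_right] using h.symm

theorem sum_twirlMoment_diag (A : TwoSite q) (hA : A.trace = 0) (a : Fin q × Fin q) :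
    ∑ b, twirlMoment A a a b b = 0 := by
  simp only [twirlMoment]
  rw [← integral_finsetSum _ fun b _ => integrable_twirl_mul_star A _ _ _ _]
  have h : ∀ U, ∑ b, twirl A U a a * star (twirl A U b b) = 0 := by
    intro U
    rw [← Finset.mul_sum, ← star_sum]
    have := trace_twirl A U
    rw [hA, Matrix.trace] at this
    simp only [diag_apply] at this
    rw [this, star_zero, mul_zero]
  simp only [h]
  simp

theorem sum_twirlMoment (A : TwoSite q) :
    ∑ p : (Fin q × Fin q) × (Fin q × Fin q), twirlMoment A p.1 p.2 p.1 p.2 = (Aᴴ * A).trace := by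
  simp only [twirlMoment]
  rw [← integral_finsetSum _ fun b _ => integrable_twirl_mul_star A _ _ _ _]
  have h : ∀ U, ∑ p : (Fin q × Fin q) × (Fin q × Fin q),
      twirl A U p.1 p.2 * star (twirl A U p.1 p.2) = (Aᴴ * A).trace := by
    intro U
    rw [← trace_conjTranspose_mul_twirl A U, Fintype.sum_prod_type, Finset.sum_comm, Matrix.trace]
    simp only [diag_apply, mul_apply, conjTranspose_apply]
    exact Finset.sum_congr rfl fun _ _ => Finset.sum_congr rfl fun _ _ => mul_comm _ _
  simp only [h]
  simp

theorem twirlMoment_eq (hq : 2 ≤ q) (A : TwoSite q) (hA : A.trace = 0) (i j k l : Fin q × Fin q) :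
    twirlMoment A i j k l = (Aᴴ * A).trace / ((q : ℂ) ^ 4 - 1) *
      ((if i = k ∧ j = l then 1 else 0) - (if i = j ∧ k = l then 1 else 0) / (q : ℂ) ^ 2) := by
  have hqR : (2 : ℝ) ≤ q := by exact_mod_cast hq
  have hq0 : (q : ℂ) ≠ 0 := by
    have : q ≠ 0 := by omega
    exact_mod_cast this
  have hq4 : (q : ℂ) ^ 4 - 1 ≠ 0 := by
    have h : (q : ℝ) ^ 4 - 1 ≠ 0 := by nlinarith [sq_nonneg ((q : ℝ) ^ 2 - 2)]
    exact_mod_cast h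
  let o : Fin q × Fin q := (⟨0, by omega⟩, ⟨0, by omega⟩)
  let o' : Fin q × Fin q := (⟨1, by omega⟩, ⟨0, by omega⟩)
  have ho : o ≠ o' := by simp [o, o']
  -- All moments are expressed by the common value `γ` of the moments `a a b b`, `a ≠ b`: vanishing
  -- trace gives the diagonal ones and the root of the transposition gives the moments `a b a b`.
  obtain ⟨γ, hγ⟩ : ∃ γ, γ = twirlMoment A o o o' o' := ⟨_, rfl⟩
  have hoff : ∀ a b, a ≠ b → twirlMoment A a a b b = γ := fun a b h => by
    rw [hγ]; exact twirlMoment_offDiag_eq A h ho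
  have hdiag : ∀ a, twirlMoment A a a a a = γ - (q : ℂ) ^ 2 * γ := by
    intro a
    have h := sum_twirlMoment_diag A hA a
    rw [← Finset.add_sum_erase _ _ (Finset.mem_univ a), Finset.sum_congr rfl
      fun b hb => hoff a b (Finset.ne_of_mem_erase hb).symm, Finset.sum_const,
      Finset.card_erase_of_mem (Finset.mem_univ a), Finset.card_univ, Fintype.card_prod,
      Fintype.card_fin, nsmul_eq_mul, Nat.cast_sub (by nlinarith)] at h
    push_cast at h
    linear_combination h
  have hall : ∀ i j k l, twirlMoment A i j k l = -((q : ℂ) ^ 2 * γ) *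
      ((if i = k ∧ j = l then 1 else 0) - (if i = j ∧ k = l then 1 else 0) / (q : ℂ) ^ 2) := by
    intro i j k l
    by_cases h1 : i = k ∧ j = l
    · obtain ⟨rfl, rfl⟩ := h1
      by_cases h2 : i = j
      · subst h2
        rw [hdiag]
        simp only [and_self, if_true]
        field_simp
        ring
      · have := twirlMoment_swap_eq_add A h2
        rw [hdiag, hoff _ _ h2] at this
        simp only [h2, and_self, if_true, if_false]
        linear_combination -this
    · by_cases h2 : i = j ∧ k = l
      · obtain ⟨rfl, rfl⟩ := h2
        have hik : i ≠ k := fun h => h1 ⟨h, h⟩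
        rw [hoff _ _ hik]
        simp only [hik, and_self, if_true, if_false]
        field_simp
        ring
      · rw [twirlMoment_eq_zero A h1 h2]
        simp [h1, h2]
  -- The invariant Hilbert–Schmidt norm fixes `γ`: the brackets sum to `q ^ 4 - 1`.
  have hsum := sum_twirlMoment A
  simp only [hall, and_self, if_true, ← Finset.mul_sum, Finset.sum_sub_distrib, ← Finset.sum_div,
    Fintype.sum_prod_type, Finset.sum_ite_eq, Finset.mem_univ, Finset.sum_const, Finset.card_univ,
    Fintype.card_prod, Fintype.card_fin, nsmul_eq_mul, mul_one] at hsum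
  push_cast at hsum
  rw [hall, ← hsum]
  field_simp

/-- Average of the squared modulus of a linear functional of `U† A U`, for a traceless `A`. -/
theorem integral_norm_sq_twirl_haar (hq : 2 ≤ q) (A : TwoSite q) (hA : A.trace = 0)
    (u : Fin q × Fin q → Fin q × Fin q → ℂ) :
    ((∫ U, ‖∑ i, ∑ j, u i j * twirl A U i j‖ ^ 2 ∂haarU2 q : ℝ) : ℂ) =
      (Aᴴ * A).trace / ((q : ℂ) ^ 4 - 1) *
        ((∑ i, ∑ j, (‖u i j‖ ^ 2 : ℝ)) - (‖∑ i, u i i‖ ^ 2 : ℝ) / (q : ℂ) ^ 2) := by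
  have hn : ∀ z : ℂ, ((‖z‖ ^ 2 : ℝ) : ℂ) = z * star z := by
    intro z
    rw [Complex.star_def, Complex.mul_conj, Complex.normSq_eq_norm_sq]
  rw [← integral_complex_ofReal]
  have h := integral_sum_twirl A (fun p : (Fin q × Fin q) × (Fin q × Fin q) => u p.1 p.2)
    (fun p => p.1) (fun p => p.2)
  have e : ∀ i j k l, u i j * star (u k l) * twirlMoment A i j k l =
      (Aᴴ * A).trace / ((q : ℂ) ^ 4 - 1) * ((if i = k then if j = l then u i j * star (u k l)
        else 0 else 0) - (if i = j then if k = l then u i j * star (u k l) else 0 else 0) /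
          (q : ℂ) ^ 2) := by
    intro i j k l
    rw [twirlMoment_eq hq A hA]
    simp only [ite_and]
    split_ifs <;> ring
  have sp : ∀ f : (Fin q × Fin q) × (Fin q × Fin q) → ℂ, ∑ p, f p = ∑ i, ∑ j, f (i, j) :=
    fun f => Fintype.sum_prod_type f
  simp only [sp, e, ← Finset.mul_sum, Finset.sum_sub_distrib,
    ← Finset.sum_div] at h
  have d1 : ∀ i j, (∑ k, ∑ l, if i = k then if j = l then u i j * star (u k l) else 0 else 0) =
      u i j * star (u i j) := by
    intro i j
    rw [Finset.sum_eq_single i (fun k _ hk => by simp [Ne.symm hk]) (by simp)]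
    simp
  have d2 : ∀ i j, (∑ k, ∑ l, if i = j then if k = l then u i j * star (u k l) else 0 else 0) =
      if i = j then u i i * star (∑ k, u k k) else 0 := by
    intro i j
    by_cases hij : i = j
    · subst hij
      simp [Finset.mul_sum]
    · simp [hij]
  simp only [d1, d2, Finset.sum_ite_eq, Finset.mem_univ, if_true, ← Finset.sum_mul] at h
  simp only [Complex.ofReal_sum, hn]
  exact h

end Moments

/-! ### Averages over a 2-design -/

section Design

variable {q : ℕ}

theorem IsTwoDesign.integral_sum_eq {κ : Type*} [Fintype κ] {μ : Measure (U2 q)}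
    (hμ : IsTwoDesign μ) (v : κ → ℂ) (s s' t t' : κ → Fin q × Fin q) :
    ∫ U : U2 q, (∑ c, v c * ((U : TwoSite q) (s c) (s' c) * star ((U : TwoSite q) (t c) (t' c)))) *
        star (∑ c, v c * ((U : TwoSite q) (s c) (s' c) * star ((U : TwoSite q) (t c) (t' c)))) ∂μ =
      ∑ c, ∑ c', v c * star (v c') *
        ∫ U : U2 q, (U : TwoSite q) (s c) (s' c) * (U : TwoSite q) (t c') (t' c') *
          star ((U : TwoSite q) (t c) (t' c)) * star ((U : TwoSite q) (s c') (s' c'))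
            ∂haarU2 q := by
  have := hμ.1
  simp only [← hμ.2, ← integral_const_mul]
  have hc : ∀ a b, Continuous fun U : U2 q => (U : TwoSite q) a b := fun a b =>
    continuous_subtype_val.matrix_elem a b
  have hi : ∀ c c', Integrable (fun U : U2 q => v c * star (v c') *
      ((U : TwoSite q) (s c) (s' c) * (U : TwoSite q) (t c') (t' c') *
          star ((U : TwoSite q) (t c) (t' c)) * star ((U : TwoSite q) (s c') (s' c')))) μ :=
    fun c c' => integrable_of_continuous_compactSpace
      (continuous_const.mul ((((hc _ _).mul (hc _ _)).mul (hc _ _).star).mul (hc _ _).star))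
  simp only [← integral_finsetSum _ fun c' _ => hi _ c']
  rw [← integral_finsetSum _ fun c _ => integrable_finsetSum _ fun c' _ => hi c c']
  congr 1
  funext U
  rw [star_sum, Finset.sum_mul_sum]
  refine Finset.sum_congr rfl fun c _ => Finset.sum_congr rfl fun c' _ => ?_
  simp only [star_mul', star_star]
  ring

theorem isTwoDesign_haarU2 : IsTwoDesign (haarU2 q) :=
  ⟨inferInstance, fun _ _ _ _ _ _ _ _ => rfl⟩

theorem complex_norm_sq (z : ℂ) : ((‖z‖ ^ 2 : ℝ) : ℂ) = z * star z := by
  rw [Complex.star_def, Complex.mul_conj, Complex.normSq_eq_norm_sq]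

/-- The integrand has degree two in the entries of `U` and two in their conjugates, exactly the
moments that a 2-design shares with Haar measure. -/
theorem IsTwoDesign.integral_norm_sq_twirl {μ : Measure (U2 q)} (hμ : IsTwoDesign μ)
    (A : TwoSite q) (u : Fin q × Fin q → Fin q × Fin q → ℂ) :
    ∫ U, ‖∑ i, ∑ j, u i j * twirl A U i j‖ ^ 2 ∂μ =
      ∫ U, ‖∑ i, ∑ j, u i j * twirl A U i j‖ ^ 2 ∂haarU2 q := by
  have e : ∀ U : U2 q, (∑ i, ∑ j, u i j * twirl A U i j) =
      ∑ c : ((Fin q × Fin q) × (Fin q × Fin q)) × ((Fin q × Fin q) × (Fin q × Fin q)),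
        (u c.1.1 c.1.2 * A c.2.1 c.2.2) * ((U : TwoSite q) c.2.2 c.1.2 *
          star ((U : TwoSite q) c.2.1 c.1.1)) := by
    intro U
    have sp : ∀ f : ((Fin q × Fin q) × (Fin q × Fin q)) × ((Fin q × Fin q) × (Fin q × Fin q)) → ℂ,
        ∑ c, f c = ∑ i, ∑ j, ∑ l, ∑ k, f ((i, j), (k, l)) := by
      intro f
      rw [Fintype.sum_prod_type, Fintype.sum_prod_type]
      refine Finset.sum_congr rfl fun i _ => Finset.sum_congr rfl fun j _ => ?_
      rw [Fintype.sum_prod_type, Finset.sum_comm]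
    rw [sp]
    refine Finset.sum_congr rfl fun i _ => Finset.sum_congr rfl fun j _ => ?_
    simp only [twirl, mul_apply, conjTranspose_apply, Finset.mul_sum, Finset.sum_mul]
    refine Finset.sum_congr rfl fun k _ => Finset.sum_congr rfl fun l _ => ?_
    ring
  apply Complex.ofReal_injective
  simp only [← integral_complex_ofReal, complex_norm_sq, e]
  rw [hμ.integral_sum_eq, isTwoDesign_haarU2.integral_sum_eq]

end Design

/-! ### Parseval's identity for operator bases -/

/-- Parseval's identity for an orthogonal family of maximal size. -/
theorem sum_norm_sq_of_orthogonal {κ ι : Type*} [Fintype κ] [Fintype ι] [DecidableEq κ]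
    (hcard : Fintype.card κ = Fintype.card ι) (B : κ → ι → ℂ) {c : ℝ} (hc : c ≠ 0)
    (hB : ∀ k l, ∑ p, star (B k p) * B l p = if k = l then (c : ℂ) else 0) (u : ι → ℂ) :
    ∑ k, ‖∑ p, B k p * u p‖ ^ 2 = c * ∑ p, ‖u p‖ ^ 2 := by
  classical
  have hc' : (c : ℂ) ≠ 0 := by exact_mod_cast hc
  have h1 : (Matrix.of fun (k : κ) p => (c : ℂ)⁻¹ * star (B k p)) *
      (Matrix.of fun p (k : κ) => B k p) = 1 := by
    ext k l
    simp only [mul_apply, of_apply, mul_assoc, ← Finset.mul_sum, hB, one_apply]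
    split_ifs <;> simp [hc']
  -- A one-sided inverse of a square matrix is two-sided, which turns orthogonality into
  -- completeness.
  rw [mul_eq_one_comm_of_card_eq _ _ _ hcard] at h1
  have h2 : ∀ p r, ∑ k, B k p * star (B k r) = if p = r then (c : ℂ) else 0 := by
    intro p r
    have := congrFun (congrFun h1 p) r
    simp only [mul_apply, of_apply, one_apply] at this
    have e : ∑ k, B k p * star (B k r) = c * ∑ k, B k p * ((c : ℂ)⁻¹ * star (B k r)) := by
      rw [Finset.mul_sum]
      refine Finset.sum_congr rfl fun k _ => ?_
      field_simp
    rw [e, this]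
    split_ifs <;> simp
  apply Complex.ofReal_injective
  rw [Complex.ofReal_mul, Complex.ofReal_sum, Complex.ofReal_sum]
  simp only [complex_norm_sq, star_sum, Finset.sum_mul_sum, star_mul']
  calc ∑ k, ∑ p, ∑ r, B k p * u p * (star (B k r) * star (u r))
      = ∑ p, ∑ r, (u p * star (u r)) * ∑ k, B k p * star (B k r) := by
        rw [Finset.sum_comm]
        refine Finset.sum_congr rfl fun p _ => ?_
        rw [Finset.sum_comm]
        refine Finset.sum_congr rfl fun r _ => ?_
        rw [Finset.mul_sum]
        exact Finset.sum_congr rfl fun k _ => by ring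
    _ = _ := by
        simp only [h2, mul_ite, mul_zero, Finset.sum_ite_eq, Finset.mem_univ, if_true,
          Finset.mul_sum]
        exact Finset.sum_congr rfl fun p _ => mul_comm _ _

theorem linearMap_apply_eq_sum {m n : Type*} [Fintype m] [Fintype n] [DecidableEq m]
    [DecidableEq n] (L : Matrix m n ℂ →ₗ[ℂ] ℂ) (X : Matrix m n ℂ) :
    L X = ∑ i, ∑ j, X i j * L (single i j 1) := by
  conv_lhs => rw [matrix_eq_sum_single X]
  simp only [map_sum]
  refine Finset.sum_congr rfl fun i _ => Finset.sum_congr rfl fun j _ => ?_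
  rw [← smul_eq_mul, ← map_smul, smul_single, smul_eq_mul, mul_one]

/-- Parseval's identity for a linear functional and an orthogonal basis of a matrix space. -/
theorem sum_norm_sq_linearMap {κ ι : Type*} [Fintype κ] [Fintype ι] [DecidableEq κ]
    [DecidableEq ι] (hcard : Fintype.card κ = Fintype.card ι ^ 2) (B : κ → Matrix ι ι ℂ) {c : ℝ}
    (hc : c ≠ 0) (hB : ∀ k l, ((B k)ᴴ * B l).trace = if k = l then (c : ℂ) else 0)
    (L : Matrix ι ι ℂ →ₗ[ℂ] ℂ) :
    ∑ k, ‖L (B k)‖ ^ 2 = c * ∑ i, ∑ j, ‖L (single i j 1)‖ ^ 2 := by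
  have h := sum_norm_sq_of_orthogonal (κ := κ) (ι := ι × ι)
    (by rw [hcard, Fintype.card_prod, sq]) (fun k p => B k p.1 p.2) hc (by
      intro k l
      rw [← hB, Fintype.sum_prod_type, Finset.sum_comm]
      simp only [Matrix.trace, diag_apply, mul_apply, conjTranspose_apply])
    (fun p => L (single p.1 p.2 1))
  simp only [Fintype.sum_prod_type] at h
  rw [← h]
  exact Finset.sum_congr rfl fun k _ => by rw [linearMap_apply_eq_sum]

section Design

variable {q : ℕ}

/-- Averaging `|L(G† A G)|²` over `G = W V W'`, with `V` drawn from a 2-design and `A` traceless,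
gives the mean of `|L|²` over the traceless elements of an orthogonal basis. -/
theorem IsTwoDesign.integral_norm_sq_linearMap (hq : 2 ≤ q) {μ : Measure (U2 q)}
    (hμ : IsTwoDesign μ) (W W' : U2 q) {A : TwoSite q} (hA : A.trace = 0)
    (hA' : (Aᴴ * A).trace = (q : ℂ) ^ 2) {κ : Type*} [Fintype κ] [DecidableEq κ]
    (hcard : Fintype.card κ = q ^ 4) (B : κ → TwoSite q) {k₀ : κ} (hB₀ : B k₀ = 1)
    (hB : ∀ k l, ((B k)ᴴ * B l).trace = if k = l then (q : ℂ) ^ 2 else 0)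
    (L : TwoSite q →ₗ[ℂ] ℂ) :
    ∫ V : U2 q, ‖L (((W : TwoSite q) * (V : TwoSite q) * (W' : TwoSite q))ᴴ * A *
        ((W : TwoSite q) * (V : TwoSite q) * (W' : TwoSite q)))‖ ^ 2 ∂μ =
      (∑ k, if k = k₀ then 0 else ‖L (B k)‖ ^ 2) / ((q : ℝ) ^ 4 - 1) := by
  have hqR : (2 : ℝ) ≤ q := by exact_mod_cast hq
  have hq0 : (q : ℝ) ≠ 0 := by positivity
  have hW'' : (W' : TwoSite q)ᴴ * (W' : TwoSite q) = 1 := mem_unitaryGroup_iff'.mp W'.2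
  -- `W'` is moved into the functional, and `W` into the operator as `twirl A W`.
  let L' : TwoSite q →ₗ[ℂ] ℂ := L ∘ₗ
    (LinearMap.mulLeft ℂ (W' : TwoSite q)ᴴ) ∘ₗ (LinearMap.mulRight ℂ (W' : TwoSite q))
  have hL' : ∀ X, L' X = L ((W' : TwoSite q)ᴴ * (X * (W' : TwoSite q))) := fun X => rfl
  have e : ∀ V : U2 q, L (((W : TwoSite q) * (V : TwoSite q) * (W' : TwoSite q))ᴴ * A *
        ((W : TwoSite q) * (V : TwoSite q) * (W' : TwoSite q))) =
      ∑ i, ∑ j, L' (single i j 1) * twirl (twirl A W) V i j := by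
    intro V
    have : L (((W : TwoSite q) * (V : TwoSite q) * (W' : TwoSite q))ᴴ * A *
        ((W : TwoSite q) * (V : TwoSite q) * (W' : TwoSite q))) = L' (twirl (twirl A W) V) := by
      rw [hL']
      congr 1
      simp only [twirl, conjTranspose_mul, Matrix.mul_assoc]
    rw [this, linearMap_apply_eq_sum]
    exact Finset.sum_congr rfl fun i _ => Finset.sum_congr rfl fun j _ => mul_comm _ _
  simp only [e]
  rw [hμ.integral_norm_sq_twirl]
  have h := integral_norm_sq_twirl_haar hq (twirl A W) (by rw [trace_twirl, hA])
    (fun i j => L' (single i j 1))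
  rw [trace_conjTranspose_mul_twirl, hA'] at h
  have hone : ∑ i, L' (single i i 1) = L 1 := by
    have h1 : L' 1 = L 1 := by rw [hL', one_mul, hW'']
    rw [← h1, linearMap_apply_eq_sum]
    refine Finset.sum_congr rfl fun i _ => ?_
    rw [Finset.sum_eq_single i (fun j _ hj => by rw [one_apply_ne hj.symm, zero_mul]) (by simp)]
    rw [one_apply_eq, one_mul]
  -- Parseval is applied to the rotated basis `W' B W'†`, on which `L'` takes the values `L (B k)`,
  -- so `W'` disappears.
  have hpars := sum_norm_sq_linearMap (by rw [hcard]; simp; ring)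
    (fun k => (W' : TwoSite q) * B k * (W' : TwoSite q)ᴴ) (c := (q : ℝ) ^ 2) (by positivity) (by
      intro k l
      have : ((W' : TwoSite q) * B k * (W' : TwoSite q)ᴴ)ᴴ *
          ((W' : TwoSite q) * B l * (W' : TwoSite q)ᴴ) =
          (W' : TwoSite q) * ((B k)ᴴ * B l) * (W' : TwoSite q)ᴴ := by
        simp only [conjTranspose_mul, conjTranspose_conjTranspose, Matrix.mul_assoc]
        rw [← Matrix.mul_assoc (W' : TwoSite q)ᴴ (W' : TwoSite q), hW'', Matrix.one_mul]
      rw [this, trace_mul_cycle, hW'', one_mul, hB]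
      push_cast
      rfl) L'
  have hLB : ∀ k, L' ((W' : TwoSite q) * B k * (W' : TwoSite q)ᴴ) = L (B k) := by
    intro k
    rw [hL']
    congr 1
    simp only [Matrix.mul_assoc, hW'', Matrix.mul_one]
    rw [← Matrix.mul_assoc, hW'', Matrix.one_mul]
  simp only [hLB] at hpars
  -- The trace term of the Haar formula is exactly the contribution of the identity element `k₀`.
  have hsplit : (∑ k, if k = k₀ then 0 else ‖L (B k)‖ ^ 2) =
      (∑ k, ‖L (B k)‖ ^ 2) - ‖L 1‖ ^ 2 := by
    rw [← hB₀, ← Finset.add_sum_erase _ _ (Finset.mem_univ k₀),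
      ← Finset.add_sum_erase _ (fun k => ‖L (B k)‖ ^ 2) (Finset.mem_univ k₀), if_pos rfl, zero_add,
      add_sub_cancel_left]
    exact Finset.sum_congr rfl fun k hk => if_neg (Finset.ne_of_mem_erase hk)
  rw [hsplit, hpars]
  apply Complex.ofReal_injective
  rw [h, hone]
  push_cast
  have : (q : ℂ) ≠ 0 := by exact_mod_cast hq0
  field_simp

end Design

/-! ### Operators on two of the sites -/

section Sites

open Function

variable {n q : ℕ}

/-- The operator `B` on the sites `i`, `j`, tensored with the `N k` on the other sites. -/
noncomputable def embed (N : Fin n → Matrix (Fin q) (Fin q) ℂ) (i j : Fin n) (B : TwoSite q) : QuditOp n q :=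
  Matrix.of fun s t => B (s i, s j) (t i, t j) *
    ∏ k, if k = i ∨ k = j then 1 else N k (s k) (t k)

theorem embed_add (N : Fin n → Matrix (Fin q) (Fin q) ℂ) (i j : Fin n) (B B' : TwoSite q) :
    embed N i j (B + B') = embed N i j B + embed N i j B' := by
  ext s t
  simp [embed, add_mul]

theorem embed_smul (N : Fin n → Matrix (Fin q) (Fin q) ℂ) (i j : Fin n) (c : ℂ) (B : TwoSite q) :
    embed N i j (c • B) = c • embed N i j B := by
  ext s t
  simp [embed, mul_assoc]

theorem sum_agree_off {i j : Fin n} (hij : i ≠ j) (s : Fin n → Fin q)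
    (f : (Fin n → Fin q) → ℂ) :
    (∑ u, if ∀ k, k ≠ i → k ≠ j → s k = u k then f u else 0) =
      ∑ p : Fin q × Fin q, f (update (update s i p.1) j p.2) := by
  rw [← Finset.sum_filter]
  have hu : ∀ u ∈ Finset.univ.filter (fun u : Fin n → Fin q => ∀ k, k ≠ i → k ≠ j → s k = u k),
      update (update s i (u i)) j (u j) = u := by
    intro u hu
    rw [Finset.mem_filter] at hu
    funext k
    by_cases hj : k = j
    · subst hj; simp
    · by_cases hi : k = i
      · subst hi; simp [hj]
      · simp [hi, hj, hu.2 k hi hj]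
  refine Finset.sum_nbij' (fun u => (u i, u j)) (fun p => update (update s i p.1) j p.2)
    (fun _ _ => Finset.mem_univ _) ?_ hu ?_ ?_
  · intro p _
    rw [Finset.mem_filter]
    exact ⟨Finset.mem_univ _, fun k hi hj => by simp [hi, hj]⟩
  · intro p _
    simp [hij]
  · intro u h
    rw [hu u h]

theorem onSites_mul_embed {i j : Fin n} (hij : i ≠ j) (N : Fin n → Matrix (Fin q) (Fin q) ℂ)
    (G B : TwoSite q) : onSites i j G * embed N i j B = embed N i j (G * B) := by
  ext s t
  simp only [mul_apply, onSites, embed, of_apply, ite_mul, zero_mul]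
  rw [sum_agree_off hij s, Finset.sum_mul]
  refine Finset.sum_congr rfl fun p _ => ?_
  simp only [update_self, update_of_ne hij]
  rw [← mul_assoc]
  congr 1
  refine Finset.prod_congr rfl fun k _ => ?_
  split_ifs with h
  · rfl
  · push Not at h
    rw [update_of_ne h.2, update_of_ne h.1]

theorem embed_mul_onSites {i j : Fin n} (hij : i ≠ j) (N : Fin n → Matrix (Fin q) (Fin q) ℂ)
    (G B : TwoSite q) : embed N i j B * onSites i j G = embed N i j (B * G) := by
  ext s t
  simp only [mul_apply, onSites, embed, of_apply, mul_ite, mul_zero, eq_comm (b := t _)]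
  rw [sum_agree_off hij t, Finset.sum_mul]
  refine Finset.sum_congr rfl fun p _ => ?_
  simp only [update_self, update_of_ne hij]
  rw [mul_right_comm]
  congr 1
  refine Finset.prod_congr rfl fun k _ => ?_
  split_ifs with h
  · rfl
  · push Not at h
    rw [update_of_ne h.2, update_of_ne h.1]

theorem conjTranspose_onSites (i j : Fin n) (G : TwoSite q) :
    (onSites i j G)ᴴ = onSites i j Gᴴ := by
  ext s t
  simp only [onSites, conjTranspose_apply, of_apply, eq_comm (a := t _)]
  split_ifs <;> simp

theorem tensorOp_update {i j : Fin n} (hij : i ≠ j) (M : Fin (q ^ 2) → Matrix (Fin q) (Fin q) ℂ)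
    (x : Fin n → Fin (q ^ 2)) (a b : Fin (q ^ 2)) :
    tensorOp M (update (update x i a) j b) =
      embed (fun k => M (x k)) i j (kroneckerMap (· * ·) (M a) (M b)) := by
  ext s t
  simp only [tensorOp, embed, of_apply, kroneckerMap_apply]
  rw [← Finset.mul_prod_erase _ _ (Finset.mem_univ i),
    ← Finset.mul_prod_erase _ _ (Finset.mem_erase.mpr ⟨hij.symm, Finset.mem_univ j⟩),
    ← Finset.mul_prod_erase Finset.univ (fun k => if k = i ∨ k = j then 1 else M (x k) (s k) (t k))
      (Finset.mem_univ i),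
    ← Finset.mul_prod_erase (Finset.univ.erase i) (fun k => if k = i ∨ k = j then 1 else _)
      (Finset.mem_erase.mpr ⟨hij.symm, Finset.mem_univ j⟩)]
  simp only [update_self, update_of_ne hij, true_or, or_true, if_true, one_mul]
  rw [← mul_assoc]
  congr 1
  refine Finset.prod_congr rfl fun k hk => ?_
  have h2 := Finset.ne_of_mem_erase hk
  have h1 := Finset.ne_of_mem_erase (Finset.mem_of_mem_erase hk)
  simp [h1, h2]

theorem tensorOp_eq_embed {i j : Fin n} (hij : i ≠ j)
    (M : Fin (q ^ 2) → Matrix (Fin q) (Fin q) ℂ) (x : Fin n → Fin (q ^ 2)) :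
    tensorOp M x = embed (fun k => M (x k)) i j (kroneckerMap (· * ·) (M (x i)) (M (x j))) := by
  rw [← tensorOp_update hij, update_eq_self, update_eq_self]

/-- The functional `B ↦ ⟨0| D† (B ⊗ N) D |0⟩` for `B` on the sites `i`, `j`. -/
noncomputable def expectation [NeZero q] (N : Fin n → Matrix (Fin q) (Fin q) ℂ) (i j : Fin n)
    (D : QuditOp n q) : TwoSite q →ₗ[ℂ] ℂ where
  toFun B := (Dᴴ * embed N i j B * D) 0 0
  map_add' B B' := by
    rw [embed_add, Matrix.mul_add, Matrix.add_mul, Matrix.add_apply]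
  map_smul' c B := by
    rw [embed_smul, Matrix.mul_smul, Matrix.smul_mul, Matrix.smul_apply, RingHom.id_apply]

theorem expectation_conj [NeZero q] {i j : Fin n} (hij : i ≠ j)
    (M : Fin (q ^ 2) → Matrix (Fin q) (Fin q) ℂ) (x : Fin n → Fin (q ^ 2)) (G : TwoSite q)
    (D : QuditOp n q) :
    ((onSites i j G * D)ᴴ * tensorOp M x * (onSites i j G * D)) 0 0 =
      expectation (fun k => M (x k)) i j D
        (Gᴴ * kroneckerMap (· * ·) (M (x i)) (M (x j)) * G) := by
  change _ = (Dᴴ * embed (fun k => M (x k)) i j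
    (Gᴴ * kroneckerMap (· * ·) (M (x i)) (M (x j)) * G) * D) 0 0
  rw [← embed_mul_onSites hij, ← onSites_mul_embed hij, ← tensorOp_eq_embed hij,
    ← conjTranspose_onSites, conjTranspose_mul]
  simp only [Matrix.mul_assoc]

theorem IsOperatorBasis.trace_eq_zero [NeZero q] {M : Fin (q ^ 2) → Matrix (Fin q) (Fin q) ℂ}
    (hM : IsOperatorBasis M) {a : Fin (q ^ 2)} (ha : a ≠ 0) : (M a).trace = 0 := by
  have h := hM.trace 0 a
  rwa [hM.zero, conjTranspose_one, one_mul, if_neg ha.symm] at h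

theorem IsOperatorBasis.trace_kronecker [NeZero q] {M : Fin (q ^ 2) → Matrix (Fin q) (Fin q) ℂ}
    (hM : IsOperatorBasis M) (k l : Fin (q ^ 2) × Fin (q ^ 2)) :
    ((kroneckerMap (· * ·) (M k.1) (M k.2))ᴴ * kroneckerMap (· * ·) (M l.1) (M l.2)).trace =
      if k = l then (q : ℂ) ^ 2 else 0 := by
  have h : (kroneckerMap (· * ·) (M k.1) (M k.2))ᴴ * kroneckerMap (· * ·) (M l.1) (M l.2) =
      kroneckerMap (· * ·) ((M k.1)ᴴ * M l.1) ((M k.2)ᴴ * M l.2) := by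
    rw [mul_kronecker_mul, conjTranspose_kronecker]
  rw [h, Matrix.trace_kronecker, hM.trace, hM.trace]
  simp only [Prod.ext_iff]
  by_cases h1 : k.1 = l.1 <;> by_cases h2 : k.2 = l.2 <;> simp [h1, h2, sq]

theorem kronecker_zero [NeZero q] {M : Fin (q ^ 2) → Matrix (Fin q) (Fin q) ℂ}
    (hM : IsOperatorBasis M) : kroneckerMap (· * ·) (M 0) (M 0) = (1 : TwoSite q) := by
  rw [hM.zero]
  exact one_kronecker_one

/-- Average over one gate. -/
theorem IsTwoDesign.integral_gate [NeZero q] (hq : 2 ≤ q)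
    {M : Fin (q ^ 2) → Matrix (Fin q) (Fin q) ℂ} (hM : IsOperatorBasis M) {μ : Measure (U2 q)}
    (hμ : IsTwoDesign μ) (W W' : U2 q) {i j : Fin n} (hij : i ≠ j) (x : Fin n → Fin (q ^ 2))
    (D : QuditOp n q) :
    ∫ V : U2 q, ‖((onSites i j ((W : TwoSite q) * (V : TwoSite q) * (W' : TwoSite q)) * D)ᴴ *
        tensorOp M x *
        (onSites i j ((W : TwoSite q) * (V : TwoSite q) * (W' : TwoSite q)) * D)) 0 0‖ ^ 2 ∂μ =
      mix i j (fun y => ‖(Dᴴ * tensorOp M y * D) 0 0‖ ^ 2) x := by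
  have := hμ.1
  simp only [expectation_conj hij]
  unfold mix
  split_ifs with hx
  · have e : ∀ V : U2 q, ((W : TwoSite q) * (V : TwoSite q) * (W' : TwoSite q))ᴴ *
        kroneckerMap (· * ·) (M (x i)) (M (x j)) *
          ((W : TwoSite q) * (V : TwoSite q) * (W' : TwoSite q)) =
          kroneckerMap (· * ·) (M (x i)) (M (x j)) := by
      intro V
      rw [hx.1, hx.2, kronecker_zero hM, mul_one]
      exact mem_unitaryGroup_iff'.mp (W * V * W').2
    simp only [e, integral_const, probReal_univ, one_smul]
    rw [tensorOp_eq_embed hij]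
    rfl
  · have htr : (kroneckerMap (· * ·) (M (x i)) (M (x j))).trace = 0 := by
      rw [Matrix.trace_kronecker]
      rcases not_and_or.mp hx with h | h
      · rw [hM.trace_eq_zero h, zero_mul]
      · rw [hM.trace_eq_zero h, mul_zero]
    rw [hμ.integral_norm_sq_linearMap hq W W' htr
      (by simpa using hM.trace_kronecker (x i, x j) (x i, x j))
      (κ := Fin (q ^ 2) × Fin (q ^ 2)) (by simp; ring)
      (fun p => kroneckerMap (· * ·) (M p.1) (M p.2)) (k₀ := 0) (kronecker_zero hM)
      (fun k l => hM.trace_kronecker k l)]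
    have hc : ((Fintype.card (Fin (q ^ 2)) : ℕ) : ℝ) ^ 2 = (q : ℝ) ^ 4 := by
      simp; ring
    rw [hc]
    congr 1
    refine Finset.sum_congr rfl fun p _ => ?_
    simp only [tensorOp_update hij]
    rfl

end Sites

/-! ### Averaging over the entangling gates -/

section Circuit

variable {n q : ℕ}

theorem reverse_prod_ofFn_succ {R : Type*} [Monoid R] {m : ℕ} (f : Fin (m + 1) → R) :
    (List.ofFn f).reverse.prod =
      f (Fin.last m) * (List.ofFn fun t : Fin m => f t.castSucc).reverse.prod := by
  rw [List.ofFn_succ', List.concat_eq_append, List.reverse_append, List.reverse_singleton,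
    List.singleton_append, List.prod_cons]

theorem continuous_reverse_prod_ofFn {X R : Type*} [TopologicalSpace X] [TopologicalSpace R]
    [Monoid R] [ContinuousMul R] {m : ℕ} {f : X → Fin m → R} (hf : ∀ t, Continuous fun v => f v t) :
    Continuous fun v => (List.ofFn (f v)).reverse.prod := by
  induction m with
  | zero => simpa using continuous_const
  | succ m ih =>
    simp only [reverse_prod_ofFn_succ]
    exact (hf _).mul (ih fun t => hf _)

theorem continuous_onSites (i j : Fin n) : Continuous (onSites i j : TwoSite q → QuditOp n q) := by
  refine continuous_matrix fun s t => ?_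
  simp only [onSites, of_apply]
  split_ifs
  · exact continuous_id.matrix_elem _ _
  · exact continuous_const

theorem continuous_norm_sq_expectation [NeZero q] {X : Type*} [TopologicalSpace X]
    {D : X → QuditOp n q} (hD : Continuous D) (T : QuditOp n q) :
    Continuous fun v => ‖((D v)ᴴ * T * D v) 0 0‖ ^ 2 :=
  ((((hD.matrix_conjTranspose.mul continuous_const).mul hD).matrix_elem 0 0).norm).pow 2

/-- The average over independent 2-design gates follows the Markov chain on strings. -/
theorem integral_circuit [NeZero q] (hq : 2 ≤ q)
    {M : Fin (q ^ 2) → Matrix (Fin q) (Fin q) ℂ} (hM : IsOperatorBasis M) (m : ℕ)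
    (g : Fin m → Fin n × Fin n) (hne : ∀ t, (g t).1 ≠ (g t).2) (W W' : Fin m → U2 q)
    (law : Fin m → Measure (U2 q)) (hlaw : ∀ t, IsTwoDesign (law t)) (x : Fin n → Fin (q ^ 2)) :
    ∫ V : Fin m → U2 q,
        ‖(((List.ofFn fun t => onSites (g t).1 (g t).2
            ((W t : TwoSite q) * (V t : TwoSite q) * (W' t : TwoSite q))).reverse.prod)ᴴ *
          tensorOp M x *
          (List.ofFn fun t => onSites (g t).1 (g t).2
            ((W t : TwoSite q) * (V t : TwoSite q) * (W' t : TwoSite q))).reverse.prod) 0 0‖ ^ 2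
        ∂(Measure.pi law) =
      evolve m g (fun y => ∏ i, ‖M (y i) 0 0‖ ^ 2) x := by
  induction m generalizing x with
  | zero =>
    have : ∀ t, IsProbabilityMeasure (law t) := fun t => (hlaw t).1
    simp [evolve, tensorOp, norm_prod, Finset.prod_pow]
  | succ m ih =>
    have hprob : ∀ t, IsProbabilityMeasure (law t) := fun t => (hlaw t).1
    let D : (Fin m → U2 q) → QuditOp n q := fun V => (List.ofFn fun t : Fin m =>
      onSites (g t.castSucc).1 (g t.castSucc).2 ((W t.castSucc : TwoSite q) * (V t : TwoSite q) *
        (W' t.castSucc : TwoSite q))).reverse.prod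
    let G : U2 q → QuditOp n q := fun v => onSites (g (Fin.last m)).1 (g (Fin.last m)).2
      ((W (Fin.last m) : TwoSite q) * (v : TwoSite q) * (W' (Fin.last m) : TwoSite q))
    have hD : Continuous D := continuous_reverse_prod_ofFn fun t =>
      (continuous_onSites _ _).comp ((continuous_const.mul
        (continuous_subtype_val.comp (continuous_apply t))).mul continuous_const)
    have hG : Continuous G := (continuous_onSites _ _).comp
      ((continuous_const.mul continuous_subtype_val).mul continuous_const)
    let F : U2 q × (Fin m → U2 q) → ℝ := fun z =>
      ‖((G z.1 * D z.2)ᴴ * tensorOp M x * (G z.1 * D z.2)) 0 0‖ ^ 2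
    have hF : Continuous F := continuous_norm_sq_expectation
      ((hG.comp continuous_fst).mul (hD.comp continuous_snd)) _
    -- Fubini splits off the last gate, which acts on `M_x` first; it is averaged with the rest `D`
    -- of the circuit held fixed.
    have hmp := measurePreserving_piFinSuccAbove law (Fin.last m)
    have h1 := hmp.integral_comp' F
    have h2 : ∀ V : Fin (m + 1) → U2 q,
        F (MeasurableEquiv.piFinSuccAbove (fun _ => U2 q) (Fin.last m) V) =
        ‖(((List.ofFn fun t => onSites (g t).1 (g t).2
            ((W t : TwoSite q) * (V t : TwoSite q) * (W' t : TwoSite q))).reverse.prod)ᴴ *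
          tensorOp M x *
          (List.ofFn fun t => onSites (g t).1 (g t).2
            ((W t : TwoSite q) * (V t : TwoSite q) * (W' t : TwoSite q))).reverse.prod) 0 0‖ ^ 2 := by
      intro V
      rw [reverse_prod_ofFn_succ]
      simp only [F, G, D, MeasurableEquiv.piFinSuccAbove_apply, Fin.insertNthEquiv_symm_apply,
        Fin.removeNth_apply, Fin.succAbove_last]
    simp only [h2] at h1
    rw [h1, integral_prod_symm F (integrable_of_continuous_compactSpace hF)]
    simp only [Fin.succAbove_last, F]
    have hgate := fun y => (hlaw (Fin.last m)).integral_gate hq hM (W (Fin.last m))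
      (W' (Fin.last m)) (hne (Fin.last m)) x (D y)
    have hi : ∀ z : Fin n → Fin (q ^ 2), Integrable (fun V => ‖((D V)ᴴ * tensorOp M z * D V) 0 0‖ ^ 2)
        (Measure.pi fun t : Fin m => law t.castSucc) := fun z =>
      integrable_of_continuous_compactSpace (continuous_norm_sq_expectation hD _)
    have ih' := fun z => ih (fun t => g t.castSucc) (fun t => hne _) (fun t => W t.castSucc)
      (fun t => W' t.castSucc) (fun t => law t.castSucc) (fun t => hlaw _) z
    change ∫ y, (∫ v, ‖((G v * D y)ᴴ * tensorOp M x * (G v * D y)) 0 0‖ ^ 2 ∂_) ∂_ = _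
    simp only [G, hgate]
    change _ = mix _ _ (evolve m _ _) x
    unfold mix
    split_ifs with hx
    · exact ih' x
    · rw [integral_div, integral_finsetSum]
      · congr 1
        refine Finset.sum_congr rfl fun p _ => ?_
        split_ifs with hp
        · simp
        · exact ih' _
      · intro p _
        split_ifs
        · simp
        · exact hi _

end Circuit

/-! ### Crossing gates and depth -/

/-- A crossing gate is sent to its layer and its site in `S`. Gates of one layer share no site, so
this is injective. -/
theorem Architecture.gates_le_depth_mul_card {n : ℕ} (A : Architecture n) (S : Finset (Fin n)) :
    A.gates S ≤ A.depth * S.card := by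
  -- `hasLayering_m` makes the set nonempty, so the infimum is attained and is not the default `0`.
  obtain ⟨layer, hl⟩ : A.HasLayering A.depth :=
    Nat.sInf_mem (s := {k | A.HasLayering k}) ⟨A.m, A.hasLayering_m⟩
  let f : Fin A.m → Fin A.depth × Fin n := fun t =>
    (layer t, if A.site₁ t ∈ S then A.site₁ t else A.site₂ t)
  have hcard : ((Finset.univ : Finset (Fin A.depth)) ×ˢ S).card = A.depth * S.card := by
    rw [Finset.card_product, Finset.card_univ, Fintype.card_fin]
  rw [← hcard]
  refine Finset.card_le_card_of_injOn f ?_ ?_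
  · intro t ht
    have ht' := (Finset.mem_filter.mp ht).2
    refine Finset.mem_coe.mpr (Finset.mem_product.mpr ⟨Finset.mem_univ _, ?_⟩)
    simp only [f]
    split_ifs with h
    · exact h
    · by_contra h'
      exact ht' ⟨fun h1 => absurd h1 h, fun h2 => absurd h2 h'⟩
  · intro s _ t _ hst
    obtain ⟨h1, h2⟩ := Prod.ext_iff.mp hst
    simp only [f] at h1 h2
    have ho : A.Overlap s t := by
      unfold Architecture.Overlap
      split_ifs at h2 <;> simp [h2]
    have ho' : A.Overlap t s := by
      unfold Architecture.Overlap
      split_ifs at h2 <;> simp [h2]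
    rcases lt_trichotomy s t with h | h | h
    · exact absurd h1 (hl s t h ho).ne
    · exact h
    · exact absurd h1.symm (hl t s h ho').ne

theorem Architecture.depth_pos {n : ℕ} (A : Architecture n) (i : Fin n) : 0 < A.depth := by
  obtain ⟨layer, -⟩ : A.HasLayering A.depth :=
    Nat.sInf_mem (s := {k | A.HasLayering k}) ⟨A.m, A.hasLayering_m⟩
  obtain ⟨t, -⟩ := A.covers i
  exact (Nat.zero_le _).trans_lt (layer t).2

/-! ### Parameterized gates -/

section Param

variable {q p : ℕ}

theorem ParamGate.mat_mem_unitaryGroup (g : ParamGate q p) (θ : Fin p → ℝ) :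
    g.mat θ ∈ unitaryGroup (Fin q × Fin q) ℂ := by
  refine mul_mem (mul_mem g.Wl.2 ?_) g.Wr.2
  rw [mem_unitaryGroup_iff, star_eq_conjTranspose, ← exp_conjTranspose, conjTranspose_smul,
    g.hermitian.eq]
  have h : star (-(Complex.I * (θ g.param : ℂ))) • g.A =
      -((-(Complex.I * (θ g.param : ℂ))) • g.A) := by
    rw [← neg_smul]
    congr 1
    simp
  rw [h, ← exp_add_of_commute _ _ (Commute.refl (_ : TwoSite q)).neg_right, add_neg_cancel,
    NormedSpace.exp_zero]

theorem paramSeq_mem_unitaryGroup (l : List (ParamGate q p)) (θ : Fin p → ℝ) :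
    paramSeq l θ ∈ unitaryGroup (Fin q × Fin q) ℂ := by
  refine Submonoid.list_prod_mem _ fun A hA => ?_
  simp only [List.mem_reverse, List.mem_map] at hA
  obtain ⟨g, -, rfl⟩ := hA
  exact g.mat_mem_unitaryGroup θ

theorem continuous_matrix_exp {m : Type*} [Fintype m] [DecidableEq m] :
    Continuous (NormedSpace.exp : Matrix m m ℂ → Matrix m m ℂ) := by
  let : NormedRing (Matrix m m ℂ) := Matrix.linftyOpNormedRing
  let : NormedAlgebra ℂ (Matrix m m ℂ) := Matrix.linftyOpNormedAlgebra
  let : NormedAlgebra ℚ (Matrix m m ℂ) := NormedAlgebra.restrictScalars ℚ ℂ _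
  exact NormedSpace.exp_continuous

theorem ParamGate.continuous_mat (g : ParamGate q p) : Continuous g.mat := by
  unfold ParamGate.mat
  refine (continuous_const.mul (continuous_matrix_exp.comp ?_)).mul continuous_const
  fun_prop

theorem continuous_paramSeq (l : List (ParamGate q p)) : Continuous (paramSeq l) := by
  unfold paramSeq
  simp only [← List.map_reverse]
  exact continuous_list_prod _ fun g _ => g.continuous_mat

theorem volume_feasible (p : ℕ) : volume (Set.Icc (0 : Fin p → ℝ) fun _ => 2 * Real.pi) ≠ 0 := by
  rw [Real.volume_Icc_pi, Finset.prod_ne_zero_iff]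
  intro i _
  simp [Real.pi_pos]

instance instIsProbabilityMeasureUniformParams (p : ℕ) :
    IsProbabilityMeasure (uniformParams p) :=
  cond_isProbabilityMeasure_of_finite (volume_feasible p)
    (isCompact_Icc.measure_lt_top).ne

/-- The parameter space is not compact, but the measure is a multiple of a restriction to a compact
box. -/
theorem integrable_prod_uniformParams {X : Type*} [TopologicalSpace X] [CompactSpace X] [T2Space X]
    [SecondCountableTopology X] [MeasurableSpace X] [BorelSpace X] {μ : Measure X}
    [IsFiniteMeasure μ] {f : X × (Fin p → ℝ) → ℝ} (hf : Continuous f) :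
    Integrable f (μ.prod (uniformParams p)) := by
  have h : μ.prod (uniformParams p) =
      (volume (Set.Icc (0 : Fin p → ℝ) fun _ => 2 * Real.pi))⁻¹ •
        (μ.prod volume).restrict (Set.univ ×ˢ Set.Icc (0 : Fin p → ℝ) fun _ => 2 * Real.pi) := by
    rw [uniformParams, ProbabilityTheory.cond, Measure.prod_smul_right, ← Measure.prod_restrict,
      Measure.restrict_univ]
  rw [h]
  refine Integrable.smul_measure ?_ (ENNReal.inv_ne_top.mpr (volume_feasible p))
  exact hf.continuousOn.integrableOn_compact (isCompact_univ.prod isCompact_Icc)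

end Param

/-! ### The average over the circuit -/

section Ansatz

variable {n q p : ℕ}

theorem Ansatz.continuous_circuit (C : Ansatz n q p) :
    Continuous fun z : (Fin C.m → U2 q) × (Fin p → ℝ) => C.circuit z.1 z.2 := by
  unfold Ansatz.circuit
  refine continuous_reverse_prod_ofFn fun t => (continuous_onSites _ _).comp ?_
  exact (((continuous_paramSeq _).comp continuous_snd).mul
    (continuous_subtype_val.comp ((continuous_apply t).comp continuous_fst))).mul
      ((continuous_paramSeq _).comp continuous_snd)

/-- With the integrals swapped, `θ` is fixed inside and the parameterized gates are fixed unitaries;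
the inner integral does not depend on them, so nothing of `θ` is left to average. -/
theorem Ansatz.g_eq_evolve [NeZero q] (hq : 2 ≤ q) {M : Fin (q ^ 2) → Matrix (Fin q) (Fin q) ℂ}
    (hM : IsOperatorBasis M) (C : Ansatz n q p) (x : Fin n → Fin (q ^ 2)) :
    C.g M x = evolve C.m (fun t => (C.site₁ t, C.site₂ t))
      (fun y => ∏ i, ‖M (y i) 0 0‖ ^ 2) x := by
  have hprob : ∀ t, IsProbabilityMeasure (C.law t) := fun t => (C.law_design t).1
  unfold Ansatz.g
  rw [integral_integral_swap]
  · have h := fun θ : Fin p → ℝ => integral_circuit hq hM C.m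
      (fun t => (C.site₁ t, C.site₂ t)) C.site_ne
      (fun t => ⟨paramSeq (C.post t) θ, paramSeq_mem_unitaryGroup _ _⟩)
      (fun t => ⟨paramSeq (C.pre t) θ, paramSeq_mem_unitaryGroup _ _⟩) C.law C.law_design x
    unfold Ansatz.circuit
    simp only at h
    simp only [h, integral_const, probReal_univ, one_smul]
  · exact integrable_prod_uniformParams
      (continuous_norm_sq_expectation C.continuous_circuit (tensorOp M x))

/-- Parseval for `X ↦ X 0 0` gives the total `q`. The identity takes `1`, and `q - 1 = (q² - 1) / (q
+ 1)`. -/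
theorem IsOperatorBasis.sum_norm_sq_entry [NeZero q] (hq : 2 ≤ q)
    {M : Fin (q ^ 2) → Matrix (Fin q) (Fin q) ℂ} (hM : IsOperatorBasis M) :
    (∑ a, if a = 0 then 0 else ‖M a 0 0‖ ^ 2) =
      ((Fintype.card (Fin (q ^ 2)) : ℝ) - 1) * (1 / ((q : ℝ) + 1)) := by
  have hq0 : (q : ℝ) ≠ 0 := by
    have : q ≠ 0 := by omega
    exact_mod_cast this
  have h := sum_norm_sq_linearMap (κ := Fin (q ^ 2)) (ι := Fin q) (by simp) M (c := q) hq0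
    (by intro k l; rw [hM.trace]; simp) (Matrix.entryLinearMap ℂ ℂ 0 0)
  simp only [Matrix.entryLinearMap_apply] at h
  have h1 : (∑ i : Fin q, ∑ j : Fin q, ‖(single i j (1 : ℂ)) 0 0‖ ^ 2) = 1 := by
    rw [Finset.sum_eq_single 0, Finset.sum_eq_single 0]
    · simp
    · intro j _ hj
      simp [hj]
    · simp
    · intro i _ hi
      simp [hi]
    · simp
  rw [h1, mul_one, ← Finset.add_sum_erase _ _ (Finset.mem_univ 0), hM.zero] at h
  rw [← Finset.add_sum_erase _ _ (Finset.mem_univ (0 : Fin (q ^ 2))), if_pos rfl, zero_add,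
    Finset.sum_congr rfl fun a ha => if_neg (Finset.ne_of_mem_erase ha)]
  simp only [one_apply_eq, norm_one, one_pow] at h
  rw [Fintype.card_fin]
  push_cast
  field_simp
  linear_combination ((q : ℝ) + 1) * h

theorem Ansatz.max_le_g [NeZero q] (hq : 2 ≤ q) {M : Fin (q ^ 2) → Matrix (Fin q) (Fin q) ℂ}
    (hM : IsOperatorBasis M) (C : Ansatz n q p) (x : Fin n → Fin (q ^ 2)) :
    max ((1 / ((q : ℝ) + 1)) ^ (support x).card *
        (1 / ((q : ℝ) ^ 2 + 1)) ^ C.gates (support x)) ((1 / ((q : ℝ) + 1)) ^ n) ≤ C.g M x := by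
  have hα : 1 < Fintype.card (Fin (q ^ 2)) := by
    rw [Fintype.card_fin]; nlinarith
  set r : ℝ := 1 / ((q : ℝ) + 1) with hr
  have hr0 : 0 ≤ r := by positivity
  have hr1 : r ≤ 1 := by
    rw [hr, div_le_one (by positivity)]
    linarith [(Nat.cast_nonneg q : (0 : ℝ) ≤ q)]
  rw [C.g_eq_evolve hq hM, evolve_prod_eq hα C.m _ C.site_ne C.covers (fun a => ‖M a 0 0‖ ^ 2) r
    (by simp [hM.zero]) (hM.sum_norm_sq_entry hq)]
  refine max_le ?_ (le_evolve hα _ _ (fun y => ?_) x)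
  · have hf : SuppAntitone fun y : Fin n → Fin (q ^ 2) => ∏ i, if y i = 0 then (1 : ℝ) else r := by
      intro y z h
      refine Finset.prod_le_prod (fun i _ => by split_ifs <;> positivity) fun i _ => ?_
      by_cases hz : z i = 0
      · simp [hz, h i hz]
      · rw [if_neg hz]
        split_ifs
        · exact hr1
        · rfl
    have h := hf.le_evolve hα C.m (fun t => (C.site₁ t, C.site₂ t)) C.site_ne
      (fun y => Finset.prod_nonneg fun i _ => by split_ifs <;> positivity) x
    refine le_trans (le_of_eq ?_) h
    rw [mul_comm]
    congr 1
    · rw [Finset.prod_ite, Finset.prod_const_one, one_mul, Finset.prod_const, Architecture.gates,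
        Fintype.card_fin]
      simp [support]
    · rw [Finset.prod_ite, Finset.prod_const_one, one_mul, Finset.prod_const]
      rfl
  · have h := Finset.prod_le_prod (s := Finset.univ) (f := fun _ : Fin n => r)
      (g := fun i => if y i = 0 then 1 else r) (fun _ _ => hr0) (fun i _ => by
        split_ifs
        · exact hr1
        · rfl)
    simpa using h

end Ansatz

/-! ### The universal constant -/

theorem rpow_neg_le_of_le {q d s k : ℕ} (hq : 2 ≤ q) (hk : k ≤ d * s) (hs : s ≤ d * s) :
    (q : ℝ) ^ (-(5 * (d : ℝ) * (s : ℝ))) ≤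
      (1 / ((q : ℝ) + 1)) ^ s * (1 / ((q : ℝ) ^ 2 + 1)) ^ k := by
  have hq2 : (2 : ℝ) ≤ q := by exact_mod_cast hq
  have hq0 : (0 : ℝ) < q := by linarith
  have hq1 : (1 : ℝ) ≤ q := by linarith
  have h1 : ((q : ℝ) + 1) ^ s ≤ (q : ℝ) ^ (2 * (d * s)) := by
    calc ((q : ℝ) + 1) ^ s ≤ ((q : ℝ) ^ 2) ^ s := by gcongr; nlinarith
      _ = (q : ℝ) ^ (2 * s) := (pow_mul _ _ _).symm
      _ ≤ _ := pow_le_pow_right₀ hq1 (by omega)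
  have h2 : ((q : ℝ) ^ 2 + 1) ^ k ≤ (q : ℝ) ^ (3 * (d * s)) := by
    calc ((q : ℝ) ^ 2 + 1) ^ k ≤ ((q : ℝ) ^ 3) ^ k := by
          gcongr
          nlinarith [mul_nonneg (sq_nonneg (q : ℝ)) (sub_nonneg.mpr hq2)]
      _ = (q : ℝ) ^ (3 * k) := (pow_mul _ _ _).symm
      _ ≤ _ := pow_le_pow_right₀ hq1 (by omega)
  have h3 : (q : ℝ) ^ (-(5 * (d : ℝ) * (s : ℝ))) = ((q : ℝ) ^ (5 * (d * s)))⁻¹ := by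
    rw [Real.rpow_neg hq0.le, ← Real.rpow_natCast]
    push_cast
    rw [mul_assoc]
  rw [h3, one_div, one_div, inv_pow, inv_pow, ← mul_inv]
  refine inv_anti₀ (by positivity) ?_
  calc _ ≤ (q : ℝ) ^ (2 * (d * s)) * (q : ℝ) ^ (3 * (d * s)) := by gcongr
    _ = _ := by rw [← pow_add]; ring_nf

theorem corollary1 :
    ∃ K : ℝ, 0 < K ∧
      ∀ (q : ℕ) [NeZero q], 2 ≤ q →
      ∀ (M : Fin (q ^ 2) → Matrix (Fin q) (Fin q) ℂ), IsOperatorBasis M →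
      ∀ (n p : ℕ) (C : Ansatz n q p) (x : Fin n → Fin (q ^ 2)),
        max ((1 / ((q : ℝ) + 1)) ^ (support x).card *
              (1 / ((q : ℝ) ^ 2 + 1)) ^ C.gates (support x))
            ((1 / ((q : ℝ) + 1)) ^ n) ≤ C.g M x ∧
        C.gates (support x) ≤ C.depth * (support x).card ∧
        max ((q : ℝ) ^ (-(K * (C.depth : ℝ) * ((support x).card : ℝ))))
            ((1 / ((q : ℝ) + 1)) ^ n) ≤ C.g M x := by
  -- `5 = 2 + 3`, from `q + 1 ≤ q ^ 2` and `q ^ 2 + 1 ≤ q ^ 3` for `q ≥ 2`.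
  refine ⟨5, by norm_num, ?_⟩
  intro q _ hq M hM n p C x
  have hg := C.max_le_g hq hM x
  have hk := C.gates_le_depth_mul_card (support x)
  refine ⟨hg, hk, max_le ?_ ((le_max_right _ _).trans hg)⟩
  refine (rpow_neg_le_of_le hq hk ?_).trans ((le_max_left _ _).trans hg)
  -- Absorbing `|x|` into `d |x|` needs `d ≥ 1`, which holds as soon as there is a site; an empty
  -- support is trivial.
  rcases (support x).eq_empty_or_nonempty with h | ⟨i, -⟩
  · simp [h]
  · exact Nat.le_mul_of_pos_left _ (C.depth_pos i)
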